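/- Let $\mathbb{N}^{(2)}$ denote the edge set of the complete graph on $\mathbb{N}$. For $m\ge 1$, an $m$-colouring is a surjective map $\Delta\colon\mathbb{N}^{(2)}\to\{1,\dots,m\}$ (that is, an edge colouring using exactly $m$ colours). For $X\subseteq\mathbb{N}$ let $\gamma_\Delta(X)=|\Delta(X^{(2)})|$ be the number of colours used on the edges with both endpoints in $X$, let $$\mathcal{F}_\Delta=\{\gamma_\Delta(X): X\subseteq\mathbb{N}\text{ infinite}\},$$ and let $\psi(m)=\min_\Delta|\mathcal{F}_\Delta|$, the minimum being over all $m$-colourings $\Delta$. There is an absolute constant $\alpha>0$ such that, for every integer $m\ge 2$ with $m\notin\{\binom n2+1,\binom n2+2: n\ge 2\}$, $$\psi(m)\ge(1+\alpha)\sqrt{2m};$$ equivalently, $|\mathcal{F}_\Delta|\ge(1+\alpha)\sqrt{2m}$ for every $m$-colouring $\Delta$. Moreover (Narayanan's conjecture), there is an absolute constant $c>0$ such that $\psi\left(\binom n2+3\right)>(1+c)n$ for every integer $n\ge 2$. -/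

import Mathlib

/-- The set of colours that an edge colouring `Δ` of the complete graph on `ℕ` uses on the edges
with both endpoints in `X`. -/
def coloursOn {C : Type*} (Δ : SimpleGraph.TopEdgeLabeling ℕ C) (X : Set ℕ) : Set C :=
  Δ '' {e : (⊤ : SimpleGraph ℕ).edgeSet | ∀ v ∈ (e : Sym2 ℕ), v ∈ X}

/-- `γ_Δ(X)`: the number of colours spanned by `X`. -/
noncomputable def numColours {C : Type*} (Δ : SimpleGraph.TopEdgeLabeling ℕ C) (X : Set ℕ) : ℕ :=
  (coloursOn Δ X).ncard

/-- `F_Δ`: the set of numbers of colours spanned by infinite subsets of `ℕ`. -/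
def spannedCounts {C : Type*} (Δ : SimpleGraph.TopEdgeLabeling ℕ C) : Set ℕ :=
  {k | ∃ X : Set ℕ, X.Infinite ∧ numColours Δ X = k}

/-- An `m`-colouring of the complete graph on `ℕ` uses *exactly* `m` colours. -/
def IsExactColouring {m : ℕ} (Δ : SimpleGraph.TopEdgeLabeling ℕ (Fin m)) : Prop :=
  Function.Surjective Δ

/-- `ψ(m)`: the minimum of `|F_Δ|` over all `m`-colourings `Δ` (see `psi_isLeast`: it is attained
for all `m ≥ 1`). -/
noncomputable def psi (m : ℕ) : ℕ :=
  sInf {k | ∃ Δ : SimpleGraph.TopEdgeLabeling ℕ (Fin m),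
    IsExactColouring Δ ∧ (spannedCounts Δ).ncard = k}

/-- With finitely many colours, `F_Δ` is a finite set, so that its `ncard` is its size. -/
theorem spannedCounts_finite {m : ℕ} (Δ : SimpleGraph.TopEdgeLabeling ℕ (Fin m)) :
    (spannedCounts Δ).Finite := by
  refine (Set.finite_Iic m).subset ?_
  rintro k ⟨X, -, rfl⟩
  have h := Set.ncard_le_ncard (Set.subset_univ (coloursOn Δ X)) (Set.toFinite _)
  rw [Set.ncard_univ, Nat.card_eq_fintype_card, Fintype.card_fin] at h
  exact h

/-- There are `m`-colourings for every `m ≥ 1`. -/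
theorem exists_isExactColouring {m : ℕ} (hm : 1 ≤ m) :
    ∃ Δ : SimpleGraph.TopEdgeLabeling ℕ (Fin m), IsExactColouring Δ := by
  let f : ℕ → (⊤ : SimpleGraph ℕ).edgeSet := fun n => ⟨s(0, n + 1), by simp⟩
  have hf : Function.Injective f := by
    intro a b h
    have h' : s(0, a + 1) = s(0, b + 1) := congrArg Subtype.val h
    simpa using h'
  let i : Fin m → (⊤ : SimpleGraph ℕ).edgeSet := fun j => f j
  have hi : Function.Injective i := hf.comp Fin.val_injective
  have : Nonempty (Fin m) := ⟨⟨0, hm⟩⟩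
  exact ⟨Function.invFun i, Function.invFun_surjective hi⟩

/-- `ψ(m)` is a genuine minimum. -/
theorem psi_isLeast {m : ℕ} (hm : 1 ≤ m) :
    IsLeast {k | ∃ Δ : SimpleGraph.TopEdgeLabeling ℕ (Fin m),
      IsExactColouring Δ ∧ (spannedCounts Δ).ncard = k} (psi m) := by
  obtain ⟨Δ, hΔ⟩ := exists_isExactColouring hm
  exact ⟨Nat.sInf_mem ⟨_, Δ, hΔ, rfl⟩, fun _ hk => Nat.sInf_le hk⟩

/-!
An infinite set `X` is replaced by a finite combinatorial object. Along a nonprincipal ultrafilter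
on `X` every vertex `x` has a limit colour, and the limit colours have a limit; for each finite `S`
there is an infinite `B` for which all edges from `x ∈ S` to `B` have the limit colour of `x` and
all edges inside `B` have the double limit (`exists_model`). Writing these as labels of singletons
and of `∅`, the number of colours on `S ∪ B` is the number of labels of subsets of `S` with at most
two elements. All these numbers are values, that is, elements of `F`, and every value arises so.

*The basic bound.* Let `p < f` be consecutive values and `A` a minimal finite set with value `f`.
Deleting any vertex loses at least `f - p` colours, and later deletions lose at least `f - p - 1`,
`f - p - 2`, … more; so there are at least `f - p` values below `f` (`gap_le`). Summation gives
`m ≤ s.choose 2 + 1`, where `s` is the number of values.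

*Stability.* If `m` is close to this bound, some gap near the top is nearly as large as possible.
For the corresponding `A` nearly every deletion must be uniform, since two different losses would
give additional values; hence `A` contains a set `S` of nearly `s` vertices on which all deletions of
one vertex, and all deletions of two vertices, lose equally many colours (`exists_uniform`). Such an
`S` is rainbow (`rainbow_of_uniform`), and it is structured: its edges to `B`, together with those
inside `B`, have at most two colours or are all different (`exists_structured`).

*Conclusion.* A structured set has `n.choose 2 + 1` or `n.choose 2 + 2` colours. If `m` is not of this
form, a structured set of largest size misses some colour, and one or two further vertices produce,
for almost every `k`, an additional value close to that of its `k`-subsets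
(`four_mul_le_card_of_injective`, `four_mul_le_card_of_card_low_le`). This multiplies the number of
values by nearly `4 / 3`, a contradiction. So `m` is smaller than `s.choose 2 + 1` by a quadratic
amount (`add_sq_le`) as soon as `s ≥ 1000`, while for smaller `s` the basic bound has enough room for
the small constant.
-/

namespace CanonicalColouring

set_option linter.unusedSectionVars false

/-! ### Colours of the faces of a labelled vertex set -/

section Labelling

variable {V : Type*} [DecidableEq V] {C : Type*} [DecidableEq C] (lab : Finset V → C)

/-- The colours of the faces of `S`, that is, of its subsets with at most two elements. The label of
a pair is the colour of that edge, the label of a singleton `{x}` the common colour of all edges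
from `x` to an infinite set `B`, and the label of `∅` the common colour of the edges inside `B`;
so `col lab S` is the set of colours that `S ∪ B` spans. -/
def col (S : Finset V) : Finset C := (S.powerset.filter fun T => T.card ≤ 2).image lab

/-- The labels of the faces of `S` with at most one element. -/
def low (S : Finset V) : Finset C := insert (lab ∅) (S.image fun x => lab {x})

/-- The colours private to `v` in `S`: those lost when `v` is deleted from `S`. -/
def priv (S : Finset V) (v : V) : Finset C := col lab S \ col lab (S.erase v)

/-- The colour of a pair in `S` occurs on no other face of `S` (pair, singleton or `∅`). -/
def Rainbow (S : Finset V) : Prop :=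
  ∀ T ⊆ S, T.card = 2 → ∀ T' ⊆ S, T'.card ≤ 2 → lab T = lab T' → T = T'

variable {lab}

theorem mem_col {S : Finset V} {c : C} :
    c ∈ col lab S ↔ ∃ T ⊆ S, T.card ≤ 2 ∧ lab T = c := by
  simp [col, and_assoc]

theorem lab_mem_col {S T : Finset V} (hT : T ⊆ S) (h2 : T.card ≤ 2) : lab T ∈ col lab S :=
  mem_col.2 ⟨T, hT, h2, rfl⟩

theorem col_mono {S S' : Finset V} (h : S ⊆ S') : col lab S ⊆ col lab S' := by
  intro c hc
  obtain ⟨T, hT, h2, rfl⟩ := mem_col.1 hc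
  exact lab_mem_col (hT.trans h) h2

theorem card_col_mono {S S' : Finset V} (h : S ⊆ S') : (col lab S).card ≤ (col lab S').card :=
  Finset.card_le_card (col_mono h)

theorem low_mono {S S' : Finset V} (h : S ⊆ S') : low lab S ⊆ low lab S' :=
  Finset.insert_subset_insert _ (Finset.image_subset_image h)

theorem mem_low {S : Finset V} {c : C} :
    c ∈ low lab S ↔ c = lab ∅ ∨ ∃ x ∈ S, lab {x} = c := by
  simp [low]

theorem low_insert (S : Finset V) (v : V) :
    low lab (insert v S) = insert (lab {v}) (low lab S) := by
  simp [low, Finset.image_insert, Finset.insert_comm]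

theorem one_le_card_low (S : Finset V) : 1 ≤ (low lab S).card :=
  Finset.card_pos.2 ⟨_, Finset.mem_insert_self _ _⟩

theorem card_pair_le (x y : V) : ({x, y} : Finset V).card ≤ 2 := Finset.card_le_two

theorem lab_mem_low {S T : Finset V} (hT : T ⊆ S) (h1 : T.card ≤ 1) : lab T ∈ low lab S := by
  rcases Nat.le_one_iff_eq_zero_or_eq_one.1 h1 with h | h
  · rw [Finset.card_eq_zero.1 h]; exact mem_low.2 (Or.inl rfl)
  · obtain ⟨x, rfl⟩ := Finset.card_eq_one.1 h
    exact mem_low.2 (Or.inr ⟨x, by simpa using hT, rfl⟩)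

theorem low_subset_col (S : Finset V) : low lab S ⊆ col lab S := by
  intro c hc
  rcases mem_low.1 hc with rfl | ⟨x, hx, rfl⟩
  · exact lab_mem_col (by simp) (by simp)
  · exact lab_mem_col (by simpa using hx) (by simp)

theorem col_eq (S : Finset V) : col lab S = (S.powersetCard 2).image lab ∪ low lab S := by
  apply Finset.Subset.antisymm
  · intro c hc
    obtain ⟨T, hT, h2, rfl⟩ := mem_col.1 hc
    rw [Finset.mem_union]
    rcases Nat.lt_or_ge T.card 2 with h | h
    · exact Or.inr (lab_mem_low hT (by omega))
    · exact Or.inl (Finset.mem_image_of_mem _ (Finset.mem_powersetCard.2 ⟨hT, by omega⟩))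
  · apply Finset.union_subset _ (low_subset_col S)
    intro c hc
    obtain ⟨T, hT, rfl⟩ := Finset.mem_image.1 hc
    rw [Finset.mem_powersetCard] at hT
    exact lab_mem_col hT.1 hT.2.le

theorem Rainbow.mono {S S' : Finset V} (h : Rainbow lab S') (hS : S ⊆ S') : Rainbow lab S :=
  fun T hT h2 T' hT' h2' he => h T (hT.trans hS) h2 T' (hT'.trans hS) h2' he

theorem Rainbow.card_col {S : Finset V} (h : Rainbow lab S) :
    (col lab S).card = S.card.choose 2 + (low lab S).card := by
  rw [col_eq, Finset.card_union_of_disjoint, Finset.card_image_of_injOn, Finset.card_powersetCard]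
  · intro T hT T' hT' he
    simp only [Finset.mem_coe, Finset.mem_powersetCard] at hT hT'
    exact h T hT.1 hT.2 T' hT'.1 hT'.2.le he
  · rw [Finset.disjoint_left]
    intro c hc hl
    obtain ⟨T, hT, rfl⟩ := Finset.mem_image.1 hc
    rw [Finset.mem_powersetCard] at hT
    rcases mem_low.1 hl with h0 | ⟨x, hx, h0⟩
    · have := h T hT.1 hT.2 ∅ (by simp) (by simp) h0
      rw [this] at hT; simp at hT
    · have := h T hT.1 hT.2 {x} (by simpa using hx) (by simp) h0.symm
      rw [this] at hT; simp at hT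

/-- If the colour of every pair in `D` also occurs on a face outside `D`, then the pairs in `D` can
be ignored in counting colours. -/
theorem card_col_add_le {X : Finset V} {D : Finset (Finset V)} (hD : D ⊆ X.powersetCard 2)
    (h : ∀ T ∈ D, ∃ T' ⊆ X, T'.card ≤ 2 ∧ T' ∉ D ∧ lab T = lab T') :
    (col lab X).card + D.card ≤ X.card.choose 2 + (low lab X).card := by
  have hsub : col lab X ⊆ (X.powersetCard 2 \ D).image lab ∪ low lab X := by
    have key : ∀ T ⊆ X, T.card ≤ 2 → T ∉ D →
        lab T ∈ (X.powersetCard 2 \ D).image lab ∪ low lab X := by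
      intro T hT h2 hn
      rw [Finset.mem_union]
      rcases Nat.lt_or_ge T.card 2 with h | h
      · exact Or.inr (lab_mem_low hT (by omega))
      · refine Or.inl (Finset.mem_image_of_mem _ (Finset.mem_sdiff.2
          ⟨Finset.mem_powersetCard.2 ⟨hT, by omega⟩, hn⟩))
    intro c hc
    obtain ⟨T, hT, h2, rfl⟩ := mem_col.1 hc
    by_cases hTD : T ∈ D
    · obtain ⟨T', hT', h2', hn', he⟩ := h T hTD
      rw [he]; exact key T' hT' h2' hn'
    · exact key T hT h2 hTD
  have h1 := (Finset.card_le_card hsub).trans (Finset.card_union_le _ _)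
  have h2 : ((X.powersetCard 2 \ D).image lab).card ≤ (X.powersetCard 2 \ D).card :=
    Finset.card_image_le
  have h3 := Finset.card_sdiff_add_card_eq_card hD
  rw [Finset.card_powersetCard] at h3
  omega

theorem card_low_le (S : Finset V) : (low lab S).card ≤ S.card + 1 :=
  (Finset.card_insert_le _ _).trans (Nat.succ_le_succ Finset.card_image_le)

/-! ### Private colours -/

theorem card_priv {S : Finset V} (v : V) :
    (priv lab S v).card + (col lab (S.erase v)).card = (col lab S).card :=
  Finset.card_sdiff_add_card_eq_card (col_mono (Finset.erase_subset _ _))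

theorem mem_of_mem_priv {S T : Finset V} {v : V} (hT : T ⊆ S) (h2 : T.card ≤ 2)
    (h : lab T ∈ priv lab S v) : v ∈ T := by
  by_contra hv
  exact (Finset.mem_sdiff.1 h).2 (lab_mem_col (Finset.subset_erase.2 ⟨hT, hv⟩) h2)

/-- The faces at `v` are the sets `{v, w}`; the singleton `{v}` is the case `w = v`. -/
theorem exists_eq_pair {T : Finset V} {v : V} (hv : v ∈ T) (h2 : T.card ≤ 2) :
    ∃ w ∈ T, T = {v, w} := by
  have h1 : (T.erase v).card ≤ 1 := by rw [Finset.card_erase_of_mem hv]; omega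
  rcases Nat.le_one_iff_eq_zero_or_eq_one.1 h1 with h | h
  · refine ⟨v, hv, ?_⟩
    rw [← Finset.insert_erase hv, Finset.card_eq_zero.1 h]; simp
  · obtain ⟨w, hw⟩ := Finset.card_eq_one.1 h
    refine ⟨w, Finset.mem_of_mem_erase (hw ▸ Finset.mem_singleton_self w), ?_⟩
    rw [← Finset.insert_erase hv, hw]

theorem priv_subset {S : Finset V} (v : V) :
    priv lab S v ⊆ S.image fun w => lab {v, w} := by
  intro c hc
  obtain ⟨T, hT, h2, rfl⟩ := mem_col.1 (Finset.mem_sdiff.1 hc).1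
  obtain ⟨w, hw, rfl⟩ := exists_eq_pair (mem_of_mem_priv hT h2 hc) h2
  exact Finset.mem_image_of_mem _ (hT hw)

theorem card_priv_le {S : Finset V} (v : V) : (priv lab S v).card ≤ S.card :=
  (Finset.card_le_card (priv_subset v)).trans Finset.card_image_le

/-- Each deleted vertex costs `v` at most one private colour, that of the edge joining them. -/
theorem card_priv_le_add {A S : Finset V} (hS : S ⊆ A) {v : V} (hv : v ∈ S) :
    (priv lab A v).card ≤ (priv lab S v).card + (A \ S).card := by
  have hsub : priv lab A v ⊆ priv lab S v ∪ (A \ S).image fun w => lab {v, w} := by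
    intro c hc
    obtain ⟨w, hw, rfl⟩ := Finset.mem_image.1 (priv_subset v hc)
    rw [Finset.mem_union]
    by_cases hwS : w ∈ S
    · left
      refine Finset.mem_sdiff.2 ⟨lab_mem_col ?_ (card_pair_le _ _), fun h => ?_⟩
      · intro x hx; rcases Finset.mem_insert.1 hx with rfl | hx
        · exact hv
        · rwa [Finset.mem_singleton.1 hx]
      · exact (Finset.mem_sdiff.1 hc).2 (col_mono (Finset.erase_subset_erase _ hS) h)
    · right
      exact Finset.mem_image_of_mem _ (Finset.mem_sdiff.2 ⟨hw, hwS⟩)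
  calc _ ≤ _ := Finset.card_le_card hsub
    _ ≤ _ := Finset.card_union_le _ _
    _ ≤ _ := Nat.add_le_add_left Finset.card_image_le _

/-- A colour is private only to vertices that lie in one fixed face of that colour. -/
theorem sum_card_priv_le (A : Finset V) :
    ∑ v ∈ A, (priv lab A v).card ≤ 2 * (col lab A).card := by
  have h1 : ∑ v ∈ A, (priv lab A v).card
      = ∑ c ∈ col lab A, (A.filter fun v => c ∈ priv lab A v).card := by
    refine Eq.trans ?_ (Finset.sum_card_bipartiteAbove_eq_sum_card_bipartiteBelow
      (fun v c => c ∈ priv lab A v))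
    refine Finset.sum_congr rfl fun v _ => ?_
    congr 1
    ext c
    simp only [Finset.mem_bipartiteAbove]
    exact ⟨fun h => ⟨(Finset.mem_sdiff.1 h).1, h⟩, fun h => h.2⟩
  rw [h1, mul_comm, ← smul_eq_mul]
  refine Finset.sum_le_card_nsmul _ _ _ fun c hc => ?_
  obtain ⟨T, hT, h2, rfl⟩ := mem_col.1 hc
  refine (Finset.card_le_card fun v hv => ?_).trans h2
  exact mem_of_mem_priv hT h2 (Finset.mem_filter.1 hv).2

theorem priv_union_subset {S : Finset V} (v w : V) :
    priv lab S v ∪ priv lab S w ⊆ col lab S \ col lab ((S.erase v).erase w) := by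
  intro c hc
  rcases Finset.mem_union.1 hc with h | h
  · refine Finset.mem_sdiff.2 ⟨(Finset.mem_sdiff.1 h).1, fun h' => (Finset.mem_sdiff.1 h).2 ?_⟩
    exact col_mono (Finset.erase_subset _ _) h'
  · refine Finset.mem_sdiff.2 ⟨(Finset.mem_sdiff.1 h).1, fun h' => (Finset.mem_sdiff.1 h).2 ?_⟩
    exact col_mono (Finset.erase_subset_erase _ (Finset.erase_subset _ _)) h'

/-- At most `2 (|S| - |priv lab S v|)` of the faces at `v` fail to be the only face of a private
colour of `v`. -/
theorem card_nonunique_le {S : Finset V} {v : V} :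
    (S.filter fun w => ¬ (lab {v, w} ∈ priv lab S v ∧
      ∀ w' ∈ S, lab {v, w'} = lab {v, w} → w' = w)).card + 2 * (priv lab S v).card
      ≤ 2 * S.card := by
  set h : V → C := fun w => lab {v, w} with hh
  set U := S.filter fun w => (h w ∈ priv lab S v ∧ ∀ w' ∈ S, h w' = h w → w' = w) with hU
  set R := S.filter fun w => ¬ (h w ∈ priv lab S v ∧ ∀ w' ∈ S, h w' = h w → w' = w) with hR
  have hUR : U.card + R.card = S.card := Finset.card_filter_add_card_filter_not _
  set Q := priv lab S v \ U.image h with hQ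
  have hQR : 2 * Q.card ≤ R.card := by
    have h1 : Q.card * 2 ≤ ∑ c ∈ Q, (R.filter fun w => h w = c).card := by
      rw [← smul_eq_mul]
      refine Finset.card_nsmul_le_sum _ _ _ fun c hc => ?_
      obtain ⟨hc1, hc2⟩ := Finset.mem_sdiff.1 hc
      obtain ⟨w, hw, rfl⟩ := Finset.mem_image.1 (priv_subset v hc1)
      have hwU : w ∉ U := fun hw' => hc2 (Finset.mem_image_of_mem h hw')
      have : ∃ w' ∈ S, h w' = h w ∧ w' ≠ w := by
        by_contra hcon
        push Not at hcon
        exact hwU (Finset.mem_filter.2 ⟨hw, hc1, hcon⟩)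
      obtain ⟨w', hw', he, hne⟩ := this
      have hw'U : w' ∉ U := fun hx => hne.symm ((Finset.mem_filter.1 hx).2.2 w hw he.symm)
      have hmem : ∀ x ∈ S, x ∉ U → x ∈ R := fun x hx hxU => by
        refine Finset.mem_filter.2 ⟨hx, fun hcon => hxU (Finset.mem_filter.2 ⟨hx, hcon⟩)⟩
      rw [← Finset.card_pair hne]
      refine Finset.card_le_card fun x hx => ?_
      rcases Finset.mem_insert.1 hx with rfl | hx
      · exact Finset.mem_filter.2 ⟨hmem _ hw' hw'U, he⟩
      · rw [Finset.mem_singleton.1 hx]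
        exact Finset.mem_filter.2 ⟨hmem _ hw hwU, rfl⟩
    have h2 : ∑ c ∈ Q, (R.filter fun w => h w = c).card ≤ R.card := by
      rw [← Finset.card_biUnion]
      · refine Finset.card_le_card fun x hx => ?_
        obtain ⟨c, _, hx⟩ := Finset.mem_biUnion.1 hx
        exact (Finset.mem_filter.1 hx).1
      · intro c _ c' _ hcc
        refine Finset.disjoint_left.2 fun x hx hx' => ?_
        exact hcc ((Finset.mem_filter.1 hx).2.symm.trans (Finset.mem_filter.1 hx').2)
    omega
  have h3 : (priv lab S v).card ≤ Q.card + U.card := by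
    have := Finset.card_le_card (Finset.subset_union_left (s₁ := priv lab S v) (s₂ := U.image h))
    rw [← Finset.sdiff_union_self_eq_union] at this
    exact this.trans ((Finset.card_union_le _ _).trans
      (Nat.add_le_add_left Finset.card_image_le _))
  omega

/-- For at most `2 (|S| - |priv lab S v|)` vertices `w` does deleting both `v` and `w` destroy a
colour that neither deletion destroys: such a colour occurs at `v` but is not private to `v`, and
`w` lies in a fixed face of that colour avoiding `v`. -/
theorem card_jointly_private_le {S : Finset V} {v : V} (hv : v ∈ S) :
    (S.filter fun w => ¬ (col lab S \ col lab ((S.erase v).erase w)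
      ⊆ priv lab S v ∪ priv lab S w)).card + 2 * (priv lab S v).card ≤ 2 * S.card := by
  set Z := (S.image fun w => lab {v, w}) \ priv lab S v with hZ
  have hZc : Z.card + (priv lab S v).card ≤ S.card := by
    rw [Finset.card_sdiff_add_card_eq_card (priv_subset v)]
    exact Finset.card_image_le
  have hex : ∀ z ∈ Z, ∃ T ⊆ S.erase v, T.card ≤ 2 ∧ lab T = z := by
    intro z hz
    obtain ⟨hz1, hz2⟩ := Finset.mem_sdiff.1 hz
    obtain ⟨w, hw, rfl⟩ := Finset.mem_image.1 hz1
    refine mem_col.1 ?_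
    by_contra hcon
    refine hz2 (Finset.mem_sdiff.2 ⟨lab_mem_col ?_ (card_pair_le _ _), hcon⟩)
    exact Finset.insert_subset hv (Finset.singleton_subset_iff.2 hw)
  choose! t ht1 ht2 ht3 using hex
  have hsub : (S.filter fun w => ¬ (col lab S \ col lab ((S.erase v).erase w)
      ⊆ priv lab S v ∪ priv lab S w)) ⊆ Z.biUnion t := by
    intro w hw
    obtain ⟨hwS, hw⟩ := Finset.mem_filter.1 hw
    rw [Finset.not_subset] at hw
    obtain ⟨c, hc, hcn⟩ := hw
    obtain ⟨hcS, hcvw⟩ := Finset.mem_sdiff.1 hc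
    rw [Finset.mem_union, not_or] at hcn
    have hcw : c ∈ col lab (S.erase w) := by
      by_contra hcon
      exact hcn.2 (Finset.mem_sdiff.2 ⟨hcS, hcon⟩)
    obtain ⟨T, hT, h2, hTc⟩ := mem_col.1 hcw
    have hvT : v ∈ T := by
      by_contra hvT
      apply hcvw
      rw [← hTc, Finset.erase_right_comm]
      exact lab_mem_col (Finset.subset_erase.2 ⟨hT, hvT⟩) h2
    obtain ⟨x, hx, rfl⟩ := exists_eq_pair hvT h2
    have hcZ : c ∈ Z := Finset.mem_sdiff.2
      ⟨hTc ▸ Finset.mem_image_of_mem _ (Finset.mem_of_mem_erase (hT hx)), hcn.1⟩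
    refine Finset.mem_biUnion.2 ⟨c, hcZ, ?_⟩
    by_contra hwt
    apply hcvw
    rw [← ht3 c hcZ]
    exact lab_mem_col (Finset.subset_erase.2 ⟨ht1 c hcZ, hwt⟩) (ht2 c hcZ)
  have h1 := (Finset.card_le_card hsub).trans (Finset.card_biUnion_le_card_mul Z t 2 ht2)
  omega

/-- If all deletions of one vertex lose the same number `l` of colours, with `l` close to `|S|`, and
all deletions of two vertices lose the same number, then `S` is rainbow. Counting at one vertex `v`
gives a `w` for which the edge `vw` has its colour for itself and no colour is lost only jointly;
this forces `l₂ < 2 * l`, so that every two vertices share a private colour. -/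
theorem rainbow_of_uniform {S : Finset V} {l l₂ : ℕ}
    (h1 : ∀ v ∈ S, (priv lab S v).card = l)
    (h2 : ∀ v ∈ S, ∀ w ∈ S, v ≠ w →
      (col lab S \ col lab ((S.erase v).erase w)).card = l₂)
    (hl : 3 * S.card + 1 < 4 * l) : Rainbow lab S := by
  rcases S.eq_empty_or_nonempty with rfl | ⟨v, hv⟩
  · intro T hT hc
    rw [Finset.subset_empty.1 hT] at hc; simp at hc
  have hlt : l₂ < 2 * l := by
    have hb1 := card_jointly_private_le (lab := lab) hv
    have hb2 := card_nonunique_le (lab := lab) (S := S) (v := v)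
    rw [h1 v hv] at hb1 hb2
    set B1 := (S.filter fun w => ¬ (col lab S \ col lab ((S.erase v).erase w)
      ⊆ priv lab S v ∪ priv lab S w))
    set B2 := (S.filter fun w => ¬ (lab {v, w} ∈ priv lab S v ∧
      ∀ w' ∈ S, lab {v, w'} = lab {v, w} → w' = w))
    have hlk : l ≤ S.card := (h1 v hv) ▸ card_priv_le v
    have hex : ∃ w ∈ S, w ∉ insert v (B1 ∪ B2) := by
      apply Finset.exists_mem_notMem_of_card_lt_card
      have ha := Finset.card_insert_le v (B1 ∪ B2)
      have hb := Finset.card_union_le B1 B2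
      omega
    obtain ⟨w, hw, hwn⟩ := hex
    simp only [Finset.mem_insert, Finset.mem_union, not_or] at hwn
    obtain ⟨hwv, hw1, hw2⟩ := hwn
    have hw1' : col lab S \ col lab ((S.erase v).erase w) ⊆ priv lab S v ∪ priv lab S w := by
      by_contra hcon; exact hw1 (Finset.mem_filter.2 ⟨hw, hcon⟩)
    have hw2' : lab {v, w} ∈ priv lab S v ∧ ∀ w' ∈ S, lab {v, w'} = lab {v, w} → w' = w := by
      by_contra hcon; exact hw2 (Finset.mem_filter.2 ⟨hw, hcon⟩)
    have hmem : lab {v, w} ∈ priv lab S w := by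
      refine Finset.mem_sdiff.2 ⟨(Finset.mem_sdiff.1 hw2'.1).1, fun hcon => ?_⟩
      obtain ⟨T, hT, hT2, hTc⟩ := mem_col.1 hcon
      have hTS := hT.trans (Finset.erase_subset _ _)
      have hvT : v ∈ T := mem_of_mem_priv hTS hT2 (hTc ▸ hw2'.1)
      obtain ⟨x, hx, rfl⟩ := exists_eq_pair hvT hT2
      have := hw2'.2 x (hTS hx) hTc
      exact Finset.ne_of_mem_erase (hT hx) this
    have hcard := Finset.card_union_add_card_inter (priv lab S v) (priv lab S w)
    have hpos : 0 < (priv lab S v ∩ priv lab S w).card :=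
      Finset.card_pos.2 ⟨_, Finset.mem_inter.2 ⟨hw2'.1, hmem⟩⟩
    have := Finset.card_le_card hw1'
    rw [h2 v hv w hw (Ne.symm hwv)] at this
    rw [h1 v hv, h1 w hw] at hcard
    omega
  intro T hT hT2 T' hT' hT2' he
  obtain ⟨x, y, hxy, rfl⟩ := Finset.card_eq_two.1 hT2
  have hx : x ∈ S := hT (by simp)
  have hy : y ∈ S := hT (by simp)
  have hcard := Finset.card_union_add_card_inter (priv lab S x) (priv lab S y)
  have := Finset.card_le_card (priv_union_subset (lab := lab) (S := S) x y)
  rw [h2 x hx y hy hxy] at this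
  rw [h1 x hx, h1 y hy] at hcard
  have hpos : 0 < (priv lab S x ∩ priv lab S y).card := by omega
  obtain ⟨c, hc⟩ := Finset.card_pos.1 hpos
  obtain ⟨hcx, hcy⟩ := Finset.mem_inter.1 hc
  -- every face with a colour private to both `x` and `y` is `{x, y}`
  have huniq : ∀ T ⊆ S, T.card ≤ 2 → lab T = c → T = {x, y} := by
    intro T hT h2 hTc
    have hxT : x ∈ T := mem_of_mem_priv hT h2 (hTc ▸ hcx)
    have hyT : y ∈ T := mem_of_mem_priv hT h2 (hTc ▸ hcy)
    refine (Finset.eq_of_subset_of_card_le ?_ ?_).symm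
    · exact Finset.insert_subset hxT (Finset.singleton_subset_iff.2 hyT)
    · rw [Finset.card_pair hxy]; exact h2
  obtain ⟨T₀, hT₀, h20, hTc⟩ := mem_col.1 (Finset.mem_sdiff.1 hcx).1
  have := huniq T₀ hT₀ h20 hTc
  subst this
  exact (huniq T' hT' hT2' (he ▸ hTc)).symm

end Labelling

/-! ### Counting values and uniform sets -/

/-- The number of elements of `F` below `x`. -/
def below (F : Finset ℕ) (x : ℕ) : ℕ := (F.filter (· < x)).card

theorem below_le_card (F : Finset ℕ) (x : ℕ) : below F x ≤ F.card :=
  Finset.card_le_card (Finset.filter_subset _ _)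

theorem below_mono (F : Finset ℕ) {x y : ℕ} (h : x ≤ y) : below F x ≤ below F y := by
  refine Finset.card_le_card fun z hz => ?_
  rw [Finset.mem_filter] at hz ⊢
  exact ⟨hz.1, hz.2.trans_le h⟩

theorem below_add_one_le {F : Finset ℕ} {x y : ℕ} (hx : x ∈ F) (h : x < y) :
    below F x + 1 ≤ below F y := by
  have hn : x ∉ F.filter (· < x) := by simp
  rw [below, ← Finset.card_insert_of_notMem hn]
  refine Finset.card_le_card (Finset.insert_subset (by simp [hx, h]) fun z hz => ?_)
  rw [Finset.mem_filter] at hz ⊢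
  exact ⟨hz.1, hz.2.trans h⟩

theorem below_add_one_le_card {F : Finset ℕ} {x : ℕ} (hx : x ∈ F) : below F x + 1 ≤ F.card :=
  (below_add_one_le hx (Nat.lt_succ_self x)).trans (below_le_card _ _)

theorem choose_two_succ (n : ℕ) : (n + 1).choose 2 = n + n.choose 2 := by
  rw [Nat.choose_succ_succ' n 1, Nat.choose_one_right]

section Labelling

variable {V : Type*} [DecidableEq V] {C : Type*} [DecidableEq C] {lab : Finset V → C}
  {F : Finset ℕ}

/-- A minimal vertex set with the same number of colours as `A`: every deletion loses a colour. -/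
theorem exists_critical (A : Finset V) : ∃ A₀ : Finset V,
    (col lab A₀).card = (col lab A).card ∧
      ∀ v ∈ A₀, (col lab (A₀.erase v)).card < (col lab A₀).card := by
  induction A using Finset.strongInduction with
  | H A ih =>
    by_cases h : ∀ v ∈ A, (col lab (A.erase v)).card < (col lab A).card
    · exact ⟨A, rfl, h⟩
    · push Not at h
      obtain ⟨v, hv, hle⟩ := h
      obtain ⟨A₀, h0, h1⟩ := ih _ (Finset.erase_ssubset hv)
      exact ⟨A₀, h0.trans (le_antisymm (card_col_mono (Finset.erase_subset _ _)) hle), h1⟩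

/-- Deleting vertices one at a time gives strictly decreasing values as long as every vertex keeps a
private colour. -/
theorem le_below_of_priv (hF : ∀ S, (col lab S).card ∈ F) {A : Finset V} {d : ℕ}
    (hA : ∀ v ∈ A, d ≤ (priv lab A v).card) (hdA : d ≤ A.card) (S : Finset V) (hS : S ⊆ A) :
    S.card + d ≤ below F (col lab S).card + A.card := by
  induction S using Finset.strongInduction with
  | H S ih =>
    have hSA := Finset.card_sdiff_add_card_eq_card hS
    by_cases hd : d ≤ (A \ S).card
    · omega
    rcases S.eq_empty_or_nonempty with rfl | ⟨v, hv⟩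
    · rw [Finset.card_empty]
      omega
    · have h1 := ih _ (Finset.erase_ssubset hv) ((Finset.erase_subset _ _).trans hS)
      have h2 := card_priv_le_add (lab := lab) hS hv
      have h3 := hA v (hS hv)
      have h4 := card_priv (lab := lab) (S := S) v
      have h5 := below_add_one_le (hF (S.erase v))
        (show (col lab (S.erase v)).card < (col lab S).card by omega)
      have h6 := Finset.card_erase_add_one hv
      omega

/-- If `A` has hardly more values below it than its private colours force, then a large subset of
`A` is uniform under deletion of one and of two vertices: a non-uniform deletion would show two
values (or three, for pairs) at the cost of one vertex (or two). -/
theorem exists_uniform (hF : ∀ S, (col lab S).card ∈ F) {A : Finset V} {d : ℕ}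
    (hA : ∀ v ∈ A, d ≤ (priv lab A v).card) (hdA : d ≤ A.card)
    (hd : 4 * below F (col lab A).card + 2 ≤ 5 * d) :
    ∃ S ⊆ A, A.card + 4 * d ≤ S.card + 4 * below F (col lab A).card ∧
      (∃ l, d + S.card ≤ l + A.card ∧ ∀ v ∈ S, (priv lab S v).card = l) ∧
      ∃ l₂, ∀ v ∈ S, ∀ w ∈ S, v ≠ w →
        (col lab S \ col lab ((S.erase v).erase w)).card = l₂ := by
  -- the weights make a step losing one vertex and two values, or two vertices and three values, a
  -- strict decrease
  obtain ⟨S, hSA, hmin⟩ := Finset.exists_min_image A.powerset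
    (fun S => 4 * (below F (col lab S).card : ℤ) - 5 * S.card) ⟨A, Finset.mem_powerset_self A⟩
  rw [Finset.mem_powerset] at hSA
  have hmin' : ∀ S' ⊆ S, 4 * below F (col lab S).card + 5 * S'.card
      ≤ 4 * below F (col lab S').card + 5 * S.card := by
    intro S' hS'
    have := hmin S' (Finset.mem_powerset.2 (hS'.trans hSA))
    omega
  have hsz : A.card + 4 * d ≤ S.card + 4 * below F (col lab A).card := by
    have h1 := hmin A (Finset.mem_powerset_self A)
    have h2 := le_below_of_priv hF hA hdA S hSA
    omega
  have hSA' := Finset.card_sdiff_add_card_eq_card hSA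
  have hpos : ∀ v ∈ S, d + S.card ≤ (priv lab S v).card + A.card := by
    intro v hv
    have h1 := card_priv_le_add (lab := lab) hSA hv
    have h2 := hA v (hSA hv)
    omega
  have hone : ∀ v ∈ S, ∀ w ∈ S, (col lab (S.erase v)).card ≤ (col lab (S.erase w)).card →
      (col lab (S.erase v)).card = (col lab (S.erase w)).card := by
    intro v hv w hw hle
    by_contra hne'
    have h1 := below_add_one_le (hF (S.erase v)) (lt_of_le_of_ne hle hne')
    have h2 := below_add_one_le (hF (S.erase w)) (y := (col lab S).card) (by
      have := card_priv (lab := lab) (S := S) w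
      have := hpos w hw
      omega)
    have h3 := hmin' _ (Finset.erase_subset v S)
    have h4 := Finset.card_erase_add_one hv
    omega
  have hone' : ∀ v ∈ S, ∀ w ∈ S,
      (col lab (S.erase v)).card = (col lab (S.erase w)).card := by
    intro v hv w hw
    rcases le_total (col lab (S.erase v)).card (col lab (S.erase w)).card with h | h
    · exact hone v hv w hw h
    · exact (hone w hw v hv h).symm
  have hSne : S.Nonempty := Finset.card_pos.1 (by omega)
  have hpair : ∀ v ∈ S, ∀ w ∈ S, v ≠ w → ∀ x ∈ S, ∀ y ∈ S, x ≠ y →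
      (col lab ((S.erase v).erase w)).card ≤ (col lab ((S.erase x).erase y)).card →
      (col lab ((S.erase v).erase w)).card = (col lab ((S.erase x).erase y)).card := by
    intro v hv w hw hvw x hx y hy hxy hle
    by_contra hne'
    have hy' : y ∈ S.erase x := Finset.mem_erase.2 ⟨hxy.symm, hy⟩
    have hw' : w ∈ S.erase v := Finset.mem_erase.2 ⟨hvw.symm, hw⟩
    have h1 := below_add_one_le (hF ((S.erase v).erase w)) (lt_of_le_of_ne hle hne')
    have h2 := below_add_one_le (hF ((S.erase x).erase y)) (y := (col lab (S.erase x)).card) (by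
      have h3 := card_priv (lab := lab) (S := S.erase x) y
      have h4 := card_priv_le_add (lab := lab) (Finset.erase_subset x S) hy'
      have h5 := hpos y hy
      have h6 : S \ S.erase x ⊆ {x} := by
        intro z hz; simp at hz ⊢; tauto
      have h7 := Finset.card_le_card h6
      rw [Finset.card_singleton] at h7
      omega)
    have h3 := below_add_one_le (hF (S.erase x)) (y := (col lab S).card) (by
      have := card_priv (lab := lab) (S := S) x
      have := hpos x hx
      omega)
    have h4 := hmin' ((S.erase v).erase w)
      ((Finset.erase_subset _ _).trans (Finset.erase_subset _ _))
    have h5 := Finset.card_erase_add_one hv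
    have h6 := Finset.card_erase_add_one hw'
    omega
  refine ⟨S, hSA, hsz, ?_, ?_⟩
  · obtain ⟨v, hv⟩ := hSne
    refine ⟨(priv lab S v).card, hpos v hv, fun w hw => ?_⟩
    have h1 := card_priv (lab := lab) (S := S) w
    have h2 := card_priv (lab := lab) (S := S) v
    have h3 := hone' v hv w hw
    omega
  · by_cases h : ∃ v ∈ S, ∃ w ∈ S, v ≠ w
    · obtain ⟨v, hv, w, hw, hvw⟩ := h
      refine ⟨(col lab S \ col lab ((S.erase v).erase w)).card, fun x hx y hy hxy => ?_⟩
      have hc : ∀ a b, (col lab S \ col lab ((S.erase a).erase b)).card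
          + (col lab ((S.erase a).erase b)).card = (col lab S).card := fun a b =>
        Finset.card_sdiff_add_card_eq_card
          (col_mono ((Finset.erase_subset _ _).trans (Finset.erase_subset _ _)))
      have h1 := hc v w
      have h2 := hc x y
      have h3 : (col lab ((S.erase v).erase w)).card = (col lab ((S.erase x).erase y)).card := by
        rcases le_total (col lab ((S.erase v).erase w)).card
          (col lab ((S.erase x).erase y)).card with h | h
        · exact hpair v hv w hw hvw x hx y hy hxy h
        · exact (hpair x hx y hy hxy v hv w hw hvw h).symm
      omega
    · push Not at h
      exact ⟨0, fun x hx y hy hxy => absurd (h x hx y hy) hxy⟩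

/-- In a rainbow set on which every singleton colour survives the deletion of any single vertex, three
colours of small faces give many values: for every size inside the complement `R` of a colour class
of at most half the vertices, two values differing by one occur, namely those of a set and of the
set in which a redundant vertex is exchanged for a vertex of the missing class. -/
theorem card_low_le_two_or (hF : ∀ S, (col lab S).card ∈ F) {S : Finset V}
    (hR : Rainbow lab S)
    (hlow : ∀ v ∈ S, (low lab (S.erase v)).card = (low lab S).card) (h3 : 3 ≤ (low lab S).card) :
    3 * S.card ≤ 2 * F.card + 8 := by
  have hmem : ∀ v ∈ S, lab {v} ∈ low lab (S.erase v) := by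
    intro v hv
    rw [Finset.eq_of_subset_of_card_le (low_mono (Finset.erase_subset v S)) (hlow v hv).ge]
    exact mem_low.2 (Or.inr ⟨v, hv, rfl⟩)
  -- two colours of singletons that differ from `lab ∅`; the rarer one spans at most half of `S`
  have hc : 1 < ((low lab S).erase (lab ∅)).card := by
    rw [Finset.card_erase_of_mem (mem_low.2 (Or.inl rfl))]; omega
  obtain ⟨c₁, hc1, c₂, hc2, hcc⟩ := Finset.one_lt_card.1 hc
  obtain ⟨c, c', hne, hc0', hc', hc0, hcS, hhalf⟩ : ∃ c c' : C, c ≠ c' ∧ c' ≠ lab ∅ ∧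
      c' ∈ low lab S ∧ c ≠ lab ∅ ∧ c ∈ low lab S ∧
      2 * (S.filter fun v => lab {v} = c).card ≤ S.card := by
    rw [Finset.mem_erase] at hc1 hc2
    have hdisj : Disjoint (S.filter fun v => lab {v} = c₁) (S.filter fun v => lab {v} = c₂) := by
      rw [Finset.disjoint_left]
      intro x hx hx'
      exact hcc ((Finset.mem_filter.1 hx).2.symm.trans (Finset.mem_filter.1 hx').2)
    have hle := Finset.card_le_card (Finset.union_subset
      (Finset.filter_subset (fun v => lab {v} = c₁) S)
      (Finset.filter_subset (fun v => lab {v} = c₂) S))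
    rw [Finset.card_union_of_disjoint hdisj] at hle
    rcases le_total (S.filter fun v => lab {v} = c₁).card
      (S.filter fun v => lab {v} = c₂).card with h | h
    · exact ⟨c₁, c₂, hcc, hc2.1, hc2.2, hc1.1, hc1.2, by omega⟩
    · exact ⟨c₂, c₁, hcc.symm, hc1.1, hc1.2, hc2.1, hc2.2, by omega⟩
  set R := S.filter fun v => lab {v} ≠ c with hRdef
  have hRS : R ⊆ S := Finset.filter_subset _ _
  have hcardR : S.card ≤ 2 * R.card := by
    have := Finset.card_filter_add_card_filter_not (s := S) (fun v => lab {v} = c)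
    change _ + R.card = _ at this
    omega
  obtain ⟨v₁, hv1, hv1c⟩ : ∃ v ∈ S, lab {v} = c := (mem_low.1 hcS).resolve_left hc0
  obtain ⟨z, hz, hzc⟩ : ∃ v ∈ S, lab {v} = c' := (mem_low.1 hc').resolve_left hc0'
  obtain ⟨z', hz', hzz⟩ : ∃ v ∈ S.erase z, lab {v} = lab {z} :=
    (mem_low.1 (hmem z hz)).resolve_left (hzc ▸ hc0')
  rw [Finset.mem_erase] at hz'
  have hzR : z ∈ R := Finset.mem_filter.2 ⟨hz, hzc ▸ hne.symm⟩
  have hz'R : z' ∈ R := Finset.mem_filter.2 ⟨hz'.2, by rw [hzz, hzc]; exact hne.symm⟩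
  have hstep1 : ∀ X ⊆ S, ∀ v ∈ X, (low lab (X.erase v)).card ≤ (low lab X).card :=
    fun X _ v _ => Finset.card_le_card (low_mono (Finset.erase_subset _ _))
  -- inside `R`, every size contributes two values
  have hgrow : ∀ n, ∀ X ⊆ R, z ∈ X → z' ∈ X → X.card = n + 2 →
      2 * n ≤ below F (col lab X).card := by
    intro n
    induction n with
    | zero => intros; simp
    | succ n ih =>
      intro X hX hzX hz'X hcard
      obtain ⟨x, hx, hxn⟩ := Finset.exists_mem_notMem_of_card_lt_card
        (s := {z, z'}) (t := X) (by rw [hcard]; exact (Finset.card_le_two).trans_lt (by omega))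
      simp only [Finset.mem_insert, Finset.mem_singleton, not_or] at hxn
      set Y := X.erase x with hY
      have hzY : z ∈ Y := Finset.mem_erase.2 ⟨Ne.symm hxn.1, hzX⟩
      have hz'Y : z' ∈ Y := Finset.mem_erase.2 ⟨Ne.symm hxn.2, hz'X⟩
      have hYR : Y ⊆ R := (Finset.erase_subset _ _).trans hX
      have hYc : Y.card = n + 2 := by rw [hY, Finset.card_erase_of_mem hx]; omega
      have hb := ih Y hYR hzY hz'Y hYc
      have hv1Y : v₁ ∉ Y.erase z := fun h =>
        (Finset.mem_filter.1 (hYR (Finset.mem_of_mem_erase h))).2 hv1c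
      have hN1 := (hR.mono (hX.trans hRS)).card_col
      have hN2 := (hR.mono (hYR.trans hRS)).card_col
      have hN3 := (hR.mono (show insert v₁ (Y.erase z) ⊆ S from Finset.insert_subset hv1
        (((Finset.erase_subset _ _).trans hYR).trans hRS))).card_col
      rw [Finset.card_insert_of_notMem hv1Y, Finset.card_erase_add_one hzY, low_insert,
        Finset.card_insert_of_notMem, show low lab (Y.erase z) = low lab Y from ?_] at hN3
      rotate_left
      · refine Finset.Subset.antisymm (low_mono (Finset.erase_subset _ _)) fun a ha => ?_
        rcases mem_low.1 ha with h | ⟨u, hu, rfl⟩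
        · exact mem_low.2 (Or.inl h)
        · by_cases huz : u = z
          · rw [huz, ← hzz]
            exact mem_low.2 (Or.inr ⟨z', Finset.mem_erase.2 ⟨hz'.1, hz'Y⟩, rfl⟩)
          · exact mem_low.2 (Or.inr ⟨u, Finset.mem_erase.2 ⟨huz, hu⟩, rfl⟩)
      · rw [hv1c]
        intro h
        rcases mem_low.1 h with h | ⟨u, hu, h⟩
        · exact hc0 h
        · exact (Finset.mem_filter.1 (hYR (Finset.mem_of_mem_erase hu))).2 h
      have hlow' : (low lab Y).card ≤ (low lab X).card :=
        Finset.card_le_card (low_mono (Finset.erase_subset _ _))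
      rw [hcard] at hN1
      rw [hYc] at hN2 hN3
      have hch : (n + 1 + 2).choose 2 = (n + 2) + (n + 2).choose 2 :=
        choose_two_succ _
      have hb1 := below_add_one_le (hF Y)
        (y := (col lab (insert v₁ (Y.erase z))).card) (by omega)
      have hb2 := below_add_one_le (hF (insert v₁ (Y.erase z)))
        (y := (col lab X).card) (by omega)
      omega
  -- beyond `R`, every size contributes one value
  have hgrow2 : ∀ n, ∀ X ⊆ S, R ⊆ X → X.card = n + R.card →
      below F (col lab R).card + n ≤ below F (col lab X).card := by
    intro n
    induction n with
    | zero =>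
      intro X _ hRX _
      exact below_mono _ (card_col_mono hRX)
    | succ n ih =>
      intro X hX hRX hcard
      obtain ⟨x, hx, hxn⟩ := Finset.exists_mem_notMem_of_card_lt_card (s := R) (t := X) (by omega)
      have hRY : R ⊆ X.erase x := Finset.subset_erase.2 ⟨hRX, hxn⟩
      have hYc : (X.erase x).card = n + R.card := by
        rw [Finset.card_erase_of_mem hx]; omega
      have hb := ih (X.erase x) ((Finset.erase_subset _ _).trans hX) hRY hYc
      have hN1 := (hR.mono hX).card_col
      have hN2 := (hR.mono ((Finset.erase_subset x X).trans hX)).card_col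
      have hlow' := hstep1 X hX x hx
      have hRpos : 0 < R.card := Finset.card_pos.2 ⟨z, hzR⟩
      have hch : X.card.choose 2 = (X.erase x).card + (X.erase x).card.choose 2 := by
        rw [← Finset.card_erase_add_one hx, choose_two_succ]
      have hb1 := below_add_one_le (hF (X.erase x)) (y := (col lab X).card) (by omega)
      omega
  have hR2 : 2 ≤ R.card := by
    rw [← Finset.card_pair hz'.1]
    exact Finset.card_le_card
      (Finset.insert_subset hz'R (Finset.singleton_subset_iff.2 hzR))
  have h1 := hgrow (R.card - 2) R subset_rfl hzR hz'R (by omega)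
  have h2 := hgrow2 (S.card - R.card) S subset_rfl hRS
    (by have := Finset.card_le_card hRS; omega)
  have h4 := below_le_card F (col lab S).card
  have h5 := Finset.card_le_card hRS
  omega

end Labelling

section Labelling

variable {V : Type*} [DecidableEq V] {C : Type*} [DecidableEq C] {lab : Finset V → C}
  {F : Finset ℕ}

/-! ### Structured sets -/

/-- A rainbow set in which the edges to `B` and inside `B` either have at most two colours, or are
all coloured differently. These are the extremal configurations, with `n.choose 2 + 1` or
`n.choose 2 + 2` colours. -/
def Structured (lab : Finset V → C) (S : Finset V) : Prop :=
  Rainbow lab S ∧ ((low lab S).card ≤ 2 ∨ (low lab S).card = S.card + 1)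

theorem Structured.card_col {S : Finset V} (h : Structured lab S) :
    ∃ n, S.card ≤ n ∧
      ((col lab S).card = n.choose 2 + 1 ∨ (col lab S).card = n.choose 2 + 2) := by
  have h1 := h.1.card_col
  have h2 := one_le_card_low (lab := lab) S
  rcases h.2 with h | h
  · refine ⟨S.card, le_rfl, ?_⟩
    omega
  · refine ⟨S.card + 1, Nat.le_succ _, Or.inl ?_⟩
    rw [h1, h, choose_two_succ]
    omega

theorem card_low_of_notMem {S : Finset V} (h : ∀ v ∈ S, lab {v} ∉ low lab (S.erase v)) :
    (low lab S).card = S.card + 1 := by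
  rw [low, Finset.card_insert_of_notMem, Finset.card_image_of_injOn]
  · intro x hx y hy hxy
    by_contra hne
    exact h x hx (mem_low.2 (Or.inr ⟨y, Finset.mem_erase.2 ⟨Ne.symm hne, hy⟩, hxy.symm⟩))
  · intro h0
    obtain ⟨x, hx, hx0⟩ := Finset.mem_image.1 h0
    exact h x hx (mem_low.2 (Or.inl hx0))

/-- A uniform set is rainbow, and uniformity makes either all or none of the singleton colours unique;
in the latter case three colours of small faces would give more values than `F` has. -/
theorem exists_structured (hF : ∀ S, (col lab S).card ∈ F) {A : Finset V} {d : ℕ}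
    (hA : ∀ v ∈ A, d ≤ (priv lab A v).card) (hdA : d ≤ A.card)
    (hd : 4 * below F (col lab A).card + 2 ≤ 5 * d)
    (hd' : 3 * A.card + 4 * below F (col lab A).card + 1 < 8 * d)
    (hlarge : 2 * F.card + 8 + 12 * below F (col lab A).card < 3 * A.card + 12 * d) :
    ∃ S, Structured lab S ∧ A.card + 4 * d ≤ S.card + 4 * below F (col lab A).card := by
  obtain ⟨S, hSA, hsz, ⟨l, hl, h1⟩, l₂, h2⟩ := exists_uniform hF hA hdA hd
  have hR : Rainbow lab S := rainbow_of_uniform h1 h2 (by omega)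
  refine ⟨S, ⟨hR, ?_⟩, hsz⟩
  have hlow : ∀ v ∈ S, S.card + (low lab S).card = l + 1 + (low lab (S.erase v)).card := by
    intro v hv
    have e1 := card_priv (lab := lab) (S := S) v
    rw [h1 v hv, hR.card_col, (hR.mono (Finset.erase_subset v S)).card_col,
      ← Finset.card_erase_add_one hv, choose_two_succ] at e1
    have := Finset.card_erase_add_one hv
    omega
  by_cases heq : S.card = l + 1
  · left
    by_contra hcon
    have := card_low_le_two_or hF hR (fun v hv => by have := hlow v hv; omega) (by omega)
    omega
  · right
    refine card_low_of_notMem fun v hv hmem => heq ?_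
    have e2 := hlow v hv
    have : low lab S = low lab (S.erase v) := by
      conv_lhs => rw [← Finset.insert_erase hv, low_insert]
      exact Finset.insert_eq_of_mem hmem
    rw [this] at e2
    omega

/-- Adding `v` to `S` adds a colour as soon as `S` contains the rest of a face at `v` whose colour is
new to the larger set `A`. -/
theorem lt_insert {A S T : Finset V} {v : V} (hS : S ⊆ A) (hT : T.erase v ⊆ S)
    (h2 : T.card ≤ 2) (hn : lab T ∉ col lab A) :
    (col lab S).card < (col lab (insert v S)).card := by
  refine Finset.card_lt_card ⟨col_mono (Finset.subset_insert _ _), fun h => hn ?_⟩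
  exact col_mono hS (h (lab_mem_col (Finset.subset_insert_iff.2 hT) h2))

/-- At most one vertex is needed to see all colours of small faces if there are at most two. -/
theorem exists_low_eq {A : Finset V} (h : (low lab A).card ≤ 2) :
    ∃ S₀ ⊆ A, S₀.card ≤ 1 ∧ low lab S₀ = low lab A := by
  by_cases hx : ∃ x ∈ A, lab {x} ≠ lab ∅
  · obtain ⟨x, hx, hne⟩ := hx
    have hsub : ({x} : Finset V) ⊆ A := Finset.singleton_subset_iff.2 hx
    refine ⟨{x}, hsub, by simp, Finset.eq_of_subset_of_card_le (low_mono hsub) (h.trans ?_)⟩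
    rw [low, Finset.image_singleton, Finset.card_pair hne.symm]
  · push Not at hx
    refine ⟨∅, by simp, by simp, Finset.Subset.antisymm (low_mono (by simp)) fun c hc => ?_⟩
    rcases mem_low.1 hc with h | ⟨x, hxA, rfl⟩
    · exact mem_low.2 (Or.inl h)
    · exact mem_low.2 (Or.inl (hx x hxA))

theorem exists_of_not_rainbow {X : Finset V} (h : ¬ Rainbow lab X) :
    ∃ T ⊆ X, T.card = 2 ∧ ∃ T' ⊆ X, T'.card ≤ 2 ∧ lab T = lab T' ∧ T ≠ T' := by
  unfold Rainbow at h
  push Not at h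
  exact h

theorem card_col_add_one_le {X T T' : Finset V} (hT : T ⊆ X) (h2 : T.card = 2) (hT' : T' ⊆ X)
    (h2' : T'.card ≤ 2) (he : lab T = lab T') (hne : T ≠ T') :
    (col lab X).card + 1 ≤ X.card.choose 2 + (low lab X).card := by
  have := card_col_add_le (lab := lab) (X := X) (D := {T})
    (by simpa [Finset.mem_powersetCard] using ⟨hT, h2⟩)
    (fun U hU => by
      rw [Finset.mem_singleton.1 hU]
      exact ⟨T', hT', h2', by simpa using hne.symm, he⟩)
  simpa using this

theorem card_col_add_two_le {X T₁ T₂ U₁ U₂ : Finset V} (hT₁ : T₁ ⊆ X) (h1 : T₁.card = 2)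
    (hT₂ : T₂ ⊆ X) (h2 : T₂.card = 2) (hU₁ : U₁ ⊆ X) (hc1 : U₁.card ≤ 2) (hU₂ : U₂ ⊆ X)
    (hc2 : U₂.card ≤ 2) (hne : T₁ ≠ T₂) (he1 : lab T₁ = lab U₁) (he2 : lab T₂ = lab U₂)
    (h11 : U₁ ≠ T₁) (h21 : U₂ ≠ T₁) (h22 : U₂ ≠ T₂) :
    (col lab X).card + 2 ≤ X.card.choose 2 + (low lab X).card := by
  have := card_col_add_le (lab := lab) (X := X) (D := {T₁, T₂})
    (by
      refine Finset.insert_subset (Finset.mem_powersetCard.2 ⟨hT₁, h1⟩)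
        (Finset.singleton_subset_iff.2 (Finset.mem_powersetCard.2 ⟨hT₂, h2⟩)))
    (fun W hW => by
      have hU₂' : U₂ ∉ ({T₁, T₂} : Finset (Finset V)) := by simp [h21, h22]
      rcases Finset.mem_insert.1 hW with rfl | hW
      · by_cases h12 : U₁ = T₂
        · exact ⟨U₂, hU₂, hc2, hU₂', by rw [he1, h12, he2]⟩
        · exact ⟨U₁, hU₁, hc1, by simp [h11, h12], he1⟩
      · rw [Finset.mem_singleton.1 hW]
        exact ⟨U₂, hU₂, hc2, hU₂', he2⟩)
  rwa [Finset.card_pair hne] at this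

/-- Either one of `v` and `w` adds a new colour to `S`, or together they add exactly the colour of
the edge `vw`. -/
theorem exists_between_of_pair (hF : ∀ S, (col lab S).card ∈ F) {A S : Finset V} {v w : V} {M : ℕ}
    (hS : S ⊆ A) (hvw : lab {v, w} ∉ col lab A)
    (hv : (col lab (insert v S)).card < M) (hw : (col lab (insert w S)).card < M)
    (hM : (col lab S).card + 1 < M) :
    ∃ y ∈ F, (col lab S).card < y ∧ y < M := by
  by_cases h1 : (col lab S).card < (col lab (insert v S)).card
  · exact ⟨_, hF _, h1, hv⟩
  by_cases h2 : (col lab S).card < (col lab (insert w S)).card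
  · exact ⟨_, hF _, h2, hw⟩
  have e1 := Finset.eq_of_subset_of_card_le
    (col_mono (lab := lab) (Finset.subset_insert v S)) (not_lt.1 h1)
  have e2 := Finset.eq_of_subset_of_card_le
    (col_mono (lab := lab) (Finset.subset_insert w S)) (not_lt.1 h2)
  refine ⟨_, hF (insert v (insert w S)), ?_⟩
  have : col lab (insert v (insert w S)) = insert (lab {v, w}) (col lab S) := by
    apply Finset.Subset.antisymm
    · intro c hc
      obtain ⟨T, hT, hc2, rfl⟩ := mem_col.1 hc
      rw [Finset.mem_insert]
      by_cases hvT : v ∈ T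
      · obtain ⟨x, hx, rfl⟩ := exists_eq_pair hvT hc2
        by_cases hxw : x = w
        · left; rw [hxw]
        · right
          rw [e1]
          refine lab_mem_col (Finset.insert_subset (Finset.mem_insert_self _ _)
            (Finset.singleton_subset_iff.2 ?_)) hc2
          have := hT hx
          simp only [Finset.mem_insert, hxw, false_or] at this ⊢
          exact this
      · right
        rw [e2]
        exact lab_mem_col ((Finset.subset_insert_iff_of_notMem hvT).1 hT) hc2
    · refine Finset.insert_subset (lab_mem_col ?_ (card_pair_le _ _))
        (col_mono ((Finset.subset_insert _ _).trans (Finset.subset_insert _ _)))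
      intro z hz
      simp only [Finset.mem_insert, Finset.mem_singleton] at hz ⊢
      tauto
  rw [this, Finset.card_insert_of_notMem fun h => hvw (col_mono hS h)]
  exact ⟨Nat.lt_succ_self _, hM⟩

/-- If `F` contains a sequence `G` with growing gaps and, for each `k`, a further value near `G k`,
then blocks of three consecutive indices show four values each. -/
theorem four_mul_le_card {F : Finset ℕ} {G : ℕ → ℕ} {a : ℕ} (hG : ∀ k, k ≤ a → 1 ≤ k → G k ∈ F)
    (hgap : ∀ k, G k + k ≤ G (k + 1))
    (hy : ∀ k, 13 ≤ k → k < a →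
      ∃ y ∈ F, G (k - 1) < y ∧ y < G (k + 2) ∧ y ≠ G k ∧ y ≠ G (k + 1))
    (n : ℕ) (hn : 3 * n + 12 ≤ a) : 4 * n ≤ F.card := by
  suffices h : 4 * n ≤ below F (G (3 * n + 13)) from h.trans (below_le_card _ _)
  induction n with
  | zero => simp
  | succ n ih =>
    have h0 := ih (by omega)
    have g1 := hgap (3 * n + 13)
    have g2 := hgap (3 * n + 14)
    have g3 := hgap (3 * n + 15)
    have m1 := hG (3 * n + 13) (by omega) (by omega)
    have m2 := hG (3 * n + 14) (by omega) (by omega)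
    have m3 := hG (3 * n + 15) (by omega) (by omega)
    obtain ⟨y, hyF, y1, y2, y3, y4⟩ := hy (3 * n + 14) (by omega) (by omega)
    simp only [Nat.add_assoc, Nat.reduceAdd,
      show 3 * n + 14 - 1 = 3 * n + 13 by omega] at g1 g2 g3 y1 y2 y3 y4
    rw [show 3 * (n + 1) + 13 = 3 * n + 16 by omega]
    rcases lt_or_gt_of_ne y3 with h | h
    · have b1 := below_add_one_le m1 y1
      have b2 := below_add_one_le hyF h
      have b3 := below_add_one_le m2 (y := G (3 * n + 15)) (by omega)
      have b4 := below_add_one_le m3 (y := G (3 * n + 16)) (by omega)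
      omega
    rcases lt_or_gt_of_ne y4 with h' | h'
    · have b1 := below_add_one_le m1 (y := G (3 * n + 14)) (by omega)
      have b2 := below_add_one_le m2 h
      have b3 := below_add_one_le hyF h'
      have b4 := below_add_one_le m3 (y := G (3 * n + 16)) (by omega)
      omega
    · have b1 := below_add_one_le m1 (y := G (3 * n + 14)) (by omega)
      have b2 := below_add_one_le m2 (y := G (3 * n + 15)) (by omega)
      have b3 := below_add_one_le m3 h'
      have b4 := below_add_one_le hyF (y := G (3 * n + 16)) (by omega)
      omega

end Labelling

section Labelling

variable {V : Type*} [DecidableEq V] {C : Type*} [DecidableEq C] {lab : Finset V → C}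
  {F : Finset ℕ}

/-! ### Extending a maximal structured set -/

/-- A colour missing from `A` appears on adding a single vertex, or else on an edge between two
outside vertices neither of which adds a colour. -/
theorem exists_new_face {A : Finset V} (hnew : ∃ T : Finset V, T.card ≤ 2 ∧ lab T ∉ col lab A) :
    (∃ v ∉ A, ∃ T ⊆ insert v A, T.card ≤ 2 ∧ lab T ∉ col lab A) ∨
      ((∀ v, col lab (insert v A) = col lab A) ∧
        ∃ v ∉ A, ∃ w ∉ A, lab {v, w} ∉ col lab A) := by
  by_cases h : ∃ v ∉ A, ∃ T ⊆ insert v A, T.card ≤ 2 ∧ lab T ∉ col lab A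
  · exact Or.inl h
  right
  push Not at h
  have hins : ∀ v, col lab (insert v A) = col lab A := by
    intro v
    by_cases hv : v ∈ A
    · rw [Finset.insert_eq_of_mem hv]
    · refine Finset.Subset.antisymm (fun c hc => ?_) (col_mono (Finset.subset_insert _ _))
      obtain ⟨T, hT, h2, rfl⟩ := mem_col.1 hc
      exact h v hv T hT h2
  refine ⟨hins, ?_⟩
  obtain ⟨T, h2, hn⟩ := hnew
  have hTA : ¬ T ⊆ A := fun hTA => hn (lab_mem_col hTA h2)
  obtain ⟨v, hvT, hvA⟩ := Finset.not_subset.1 hTA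
  obtain ⟨w, hw, rfl⟩ := exists_eq_pair hvT h2
  refine ⟨v, hvA, w, fun hwA => hn ?_, hn⟩
  rw [← hins v]
  exact lab_mem_col (Finset.insert_subset (Finset.mem_insert_self _ _)
    (Finset.singleton_subset_iff.2 (Finset.mem_insert_of_mem hwA))) h2

theorem low_eq_of_subset {S₀ S A : Finset V} (h : low lab S₀ = low lab A) (h0 : S₀ ⊆ S)
    (hS : S ⊆ A) : low lab S = low lab A :=
  Finset.Subset.antisymm (low_mono hS) (h ▸ low_mono h0)

/-- A maximal structured set with pairwise different colours on its small faces. Its subsets of size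
`k` have `(k + 1).choose 2 + 1` colours; outside vertices fail to be structured because of a
repetition, which is visible over a bounded subset, so that adding them gives a value strictly
between two consecutive ones of these. -/
theorem four_mul_le_card_of_injective (hF : ∀ S, (col lab S).card ∈ F) {A : Finset V}
    (hR : Rainbow lab A) (hlow : (low lab A).card = A.card + 1)
    (hmax : ∀ v ∉ A, ¬ Structured lab (insert v A))
    (hnew : ∃ T : Finset V, T.card ≤ 2 ∧ lab T ∉ col lab A) {n : ℕ} (hn : 3 * n + 12 ≤ A.card) :
    4 * n ≤ F.card := by
  have hlowS : ∀ S ⊆ A, (low lab S).card = S.card + 1 := by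
    intro S hS
    refine card_low_of_notMem fun v hv hmem => ?_
    have h1 : low lab A = low lab (A.erase v) := by
      conv_lhs => rw [← Finset.insert_erase (hS hv), low_insert]
      exact Finset.insert_eq_of_mem (low_mono (Finset.erase_subset_erase _ hS) hmem)
    have h2 := card_low_le (lab := lab) (A.erase v)
    rw [← h1, hlow, Finset.card_erase_add_one (hS hv)] at h2
    omega
  have hN : ∀ S ⊆ A, (col lab S).card = (S.card + 1).choose 2 + 1 := by
    intro S hS
    rw [(hR.mono hS).card_col, hlowS S hS, choose_two_succ]
    omega
  -- a bounded set of vertices forces a repetition among the colours at `v`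
  have hrep : ∀ v ∉ A, ∃ W ⊆ A, W.card ≤ 4 ∧ ∀ S, W ⊆ S → S ⊆ A →
      (col lab (insert v S)).card < (S.card + 2).choose 2 + 1 := by
    intro v hv
    have hlow1 : ∀ S ⊆ A, (low lab (insert v S)).card ≤ S.card + 2 := by
      intro S hS
      rw [low_insert]
      exact (Finset.card_insert_le _ _).trans (by rw [hlowS S hS])
    by_cases hRv : Rainbow lab (insert v A)
    · have hl : (low lab (insert v A)).card ≠ (insert v A).card + 1 :=
        fun h => hmax v hv ⟨hRv, Or.inr h⟩
      have hmem : lab {v} ∈ low lab A := by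
        by_contra hcon
        apply hl
        rw [low_insert, Finset.card_insert_of_notMem hcon, hlow, Finset.card_insert_of_notMem hv]
      have hW : ∃ W ⊆ A, W.card ≤ 1 ∧ lab {v} ∈ low lab W := by
        rcases mem_low.1 hmem with h | ⟨x, hx, h⟩
        · exact ⟨∅, by simp, by simp, mem_low.2 (Or.inl h)⟩
        · exact ⟨{x}, by simpa using hx, by simp, mem_low.2 (Or.inr ⟨x, by simp, h⟩)⟩
      obtain ⟨W, hWA, hWc, hW⟩ := hW
      refine ⟨W, hWA, by omega, fun S hWS hSA => ?_⟩
      have hvS : v ∉ S := fun h => hv (hSA h)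
      rw [(hRv.mono (Finset.insert_subset_insert v hSA)).card_col, low_insert,
        Finset.insert_eq_of_mem (low_mono hWS hW), hlowS S hSA,
        Finset.card_insert_of_notMem hvS, choose_two_succ (S.card + 1)]
      omega
    · obtain ⟨T, hT, h2, T', hT', h2', he, hne⟩ := exists_of_not_rainbow hRv
      refine ⟨(T ∪ T').erase v, ?_, ?_, fun S hWS hSA => ?_⟩
      · rw [← Finset.subset_insert_iff]; exact Finset.union_subset hT hT'
      · refine (Finset.card_le_card (Finset.erase_subset _ _)).trans
          ((Finset.card_union_le _ _).trans (by omega))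
      · have hvS : v ∉ S := fun h => hv (hSA h)
        rw [← Finset.subset_insert_iff, Finset.union_subset_iff] at hWS
        have h3 := card_col_add_one_le hWS.1 h2 hWS.2 h2' he hne
        rw [Finset.card_insert_of_notMem hvS] at h3
        have h4 := hlow1 S hSA
        rw [choose_two_succ (S.card + 1)]
        omega
  refine four_mul_le_card (F := F) (G := fun k => (k + 1).choose 2 + 1) (a := A.card)
    ?_ ?_ ?_ n hn
  · intro k hk _
    obtain ⟨S, hS, hSc⟩ := Finset.exists_subset_card_eq hk
    rw [← hSc, ← hN S hS]; exact hF S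
  · intro k
    rw [choose_two_succ (k + 1)]; omega
  · intro k hk hka
    suffices h : ∃ y ∈ F, (k + 1).choose 2 + 1 < y ∧ y < (k + 2).choose 2 + 1 by
      obtain ⟨y, hy, h1, h2⟩ := h
      obtain ⟨j, rfl⟩ : ∃ j, k = j + 1 := ⟨k - 1, by omega⟩
      have e1 : (j + 1 + 1).choose 2 = j + 1 + (j + 1).choose 2 := choose_two_succ _
      have e3 : (j + 1 + 2 + 1).choose 2 = j + 1 + 2 + (j + 1 + 2).choose 2 := choose_two_succ _
      exact ⟨y, hy, show (j + 1).choose 2 + 1 < y by omega,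
        show y < (j + 1 + 2 + 1).choose 2 + 1 by omega,
        show y ≠ (j + 1 + 1).choose 2 + 1 by omega,
        show y ≠ (j + 1 + 2).choose 2 + 1 by omega⟩
    rcases exists_new_face hnew with ⟨v, hv, T, hT, h2, hTn⟩ | ⟨hins, v, hv, w, hw, hvw⟩
    · obtain ⟨W, hWA, hWc, hW⟩ := hrep v hv
      obtain ⟨S, hWS, hSA, hSc⟩ := Finset.exists_subsuperset_card_eq
        (s := W ∪ T.erase v) (t := A) (n := k)
        (Finset.union_subset hWA (Finset.subset_insert_iff.1 hT))
        (by
          have := Finset.card_union_le W (T.erase v)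
          have := Finset.card_le_card (Finset.erase_subset v T)
          omega) hka.le
      rw [Finset.union_subset_iff] at hWS
      refine ⟨_, hF (insert v S), ?_, ?_⟩
      · rw [← hSc, ← hN S hSA]
        exact lt_insert hSA hWS.2 h2 hTn
      · rw [← hSc]; exact hW S hWS.1 hSA
    · obtain ⟨W, hWA, hWc, hW⟩ := hrep v hv
      obtain ⟨W', hWA', hWc', hW'⟩ := hrep w hw
      obtain ⟨S, hWS, hSA, hSc⟩ := Finset.exists_subsuperset_card_eq
        (s := W ∪ W') (t := A) (n := k)
        (Finset.union_subset hWA hWA')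
        (by
          have := Finset.card_union_le W W'
          omega) hka.le
      rw [Finset.union_subset_iff] at hWS
      have := exists_between_of_pair hF hSA hvw (hW S hWS.1 hSA) (hW' S hWS.2 hSA) (by
        rw [hN S hSA, choose_two_succ (S.card + 1)]; omega)
      rwa [hN S hSA, hSc] at this

/-- A maximal structured set with `c ≤ 2` colours on its small faces. Subsets of size `k` have
`k.choose 2 + c` colours. A new vertex either causes two repetitions over a bounded set, giving a
value strictly between consecutive ones of these, or causes none after the removal of at most one
vertex, giving the value `(k + 1).choose 2 + c + 1`, unless that
removal lowers `c`. -/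
theorem four_mul_le_card_of_card_low_le (hF : ∀ S, (col lab S).card ∈ F) {A : Finset V}
    (hR : Rainbow lab A) (hlow : (low lab A).card ≤ 2)
    (hmax : ∀ v ∉ A, ¬ Structured lab (insert v A))
    (hnew : ∃ T : Finset V, T.card ≤ 2 ∧ lab T ∉ col lab A) {n : ℕ} (hn : 3 * n + 12 ≤ A.card) :
    4 * n ≤ F.card := by
  obtain ⟨S₀, hS₀A, hS₀c, hS₀⟩ := exists_low_eq hlow
  set c := (low lab A).card with hc
  have hc1 : 1 ≤ c := one_le_card_low A
  have hN : ∀ S, S₀ ⊆ S → S ⊆ A → (col lab S).card = S.card.choose 2 + c := by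
    intro S h0 hS
    rw [(hR.mono hS).card_col, low_eq_of_subset hS₀ h0 hS]
  have hlowv : ∀ v, ∀ S ⊆ A, (low lab (insert v S)).card ≤ c + 1 := by
    intro v S hS
    rw [low_insert]
    exact (Finset.card_insert_le _ _).trans
      (Nat.succ_le_succ (Finset.card_le_card (low_mono hS)))
  have hlowv' : ∀ v, lab {v} ∈ low lab A → ∀ S, S₀ ⊆ S → S ⊆ A →
      (low lab (insert v S)).card = c := by
    intro v hv S h0 hS
    rw [low_insert, low_eq_of_subset hS₀ h0 hS, Finset.insert_eq_of_mem hv]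
  refine four_mul_le_card (F := F) (G := fun k => k.choose 2 + c) (a := A.card)
    ?_ ?_ ?_ n hn
  · intro k hk hk1
    obtain ⟨S, h0, hS, hSc⟩ := Finset.exists_subsuperset_card_eq hS₀A (hS₀c.trans hk1) hk
    rw [← hSc, ← hN S h0 hS]; exact hF S
  · intro k
    rw [choose_two_succ k]; omega
  · intro k hk hka
    suffices h : ∃ y ∈ F, (k.choose 2 + c < y ∧ y < (k + 1).choose 2 + c) ∨
        y = (k + 1).choose 2 + c + 1 ∨ y + 1 = k.choose 2 + c by
      obtain ⟨y, hy, h⟩ := h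
      obtain ⟨j, rfl⟩ : ∃ j, k = j + 1 := ⟨k - 1, by omega⟩
      have e1 : (j + 1).choose 2 = j + j.choose 2 := choose_two_succ _
      have e2 : (j + 1 + 1).choose 2 = j + 1 + (j + 1).choose 2 := choose_two_succ _
      have e3 : (j + 1 + 2).choose 2 = j + 1 + 1 + (j + 1 + 1).choose 2 := choose_two_succ _
      exact ⟨y, hy, show j.choose 2 + c < y by omega,
        show y < (j + 1 + 2).choose 2 + c by omega,
        show y ≠ (j + 1).choose 2 + c by omega,
        show y ≠ (j + 1 + 1).choose 2 + c by omega⟩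
    rcases exists_new_face hnew with ⟨v, hv, T, hT, h2, hTn⟩ | ⟨hins, v, hv, w, hw, hvw⟩
    · have hTA : T.erase v ⊆ A := Finset.subset_insert_iff.1 hT
      have hTc : (T.erase v).card ≤ 2 :=
        (Finset.card_le_card (Finset.erase_subset v T)).trans h2
      -- a bounded set `W` witnessing a loss of two colours suffices
      have hfin : ∀ W ⊆ A, W.card ≤ 8 → (∀ S, W ⊆ S → S₀ ⊆ S → S ⊆ A →
          (col lab (insert v S)).card < (S.card + 1).choose 2 + c) →
          ∃ y ∈ F, (k.choose 2 + c < y ∧ y < (k + 1).choose 2 + c) ∨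
            y = (k + 1).choose 2 + c + 1 ∨ y + 1 = k.choose 2 + c := by
        intro W hWA hWc hW
        obtain ⟨S, hWS, hSA, hSc⟩ := Finset.exists_subsuperset_card_eq
          (s := W ∪ (S₀ ∪ T.erase v)) (t := A) (n := k)
          (Finset.union_subset hWA (Finset.union_subset hS₀A hTA))
          (by
            have := Finset.card_union_le W (S₀ ∪ T.erase v)
            have := Finset.card_union_le S₀ (T.erase v)
            omega) hka.le
        simp only [Finset.union_subset_iff] at hWS
        refine ⟨_, hF (insert v S), Or.inl ⟨?_, ?_⟩⟩
        · rw [← hSc, ← hN S hWS.2.1 hSA]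
          exact lt_insert hSA hWS.2.2 h2 hTn
        · rw [← hSc]; exact hW S hWS.1 hWS.2.1 hSA
      by_cases hRv : Rainbow lab (insert v A)
      · have hmem : lab {v} ∉ low lab A := by
          intro hmem
          refine hmax v hv ⟨hRv, Or.inl ?_⟩
          rw [hlowv' v hmem A hS₀A subset_rfl]; exact hlow
        obtain ⟨S, h0, hS, hSc⟩ := Finset.exists_subsuperset_card_eq hS₀A
          (show S₀.card ≤ k by omega) hka.le
        have hvS : v ∉ S := fun h => hv (hS h)
        refine ⟨_, hF (insert v S), Or.inr (Or.inl ?_)⟩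
        rw [(hRv.mono (Finset.insert_subset_insert v hS)).card_col, low_insert,
          low_eq_of_subset hS₀ h0 hS, Finset.card_insert_of_notMem hmem,
          Finset.card_insert_of_notMem hvS, hSc]
        omega
      obtain ⟨T₁, hT₁, hc₁, U₁, hU₁, hd₁, he₁, hne₁⟩ := exists_of_not_rainbow hRv
      by_cases hmem : lab {v} ∈ low lab A
      · refine hfin ((T₁ ∪ U₁).erase v) ?_ ?_ fun S hWS h0 hSA => ?_
        · rw [← Finset.subset_insert_iff]; exact Finset.union_subset hT₁ hU₁
        · refine (Finset.card_le_card (Finset.erase_subset _ _)).trans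
            ((Finset.card_union_le _ _).trans (by omega))
        · have hvS : v ∉ S := fun h => hv (hSA h)
          rw [← Finset.subset_insert_iff, Finset.union_subset_iff] at hWS
          have h3 := card_col_add_one_le hWS.1 hc₁ hWS.2 hd₁ he₁ hne₁
          rw [Finset.card_insert_of_notMem hvS, hlowv' v hmem S h0 hSA] at h3
          omega
      -- deleting `x` removes the repetition between `T₁` and `U₁`
      obtain ⟨x, hxT, hxv⟩ : ∃ x ∈ T₁, x ≠ v := by
        obtain ⟨x, hx⟩ : (T₁.erase v).Nonempty := Finset.card_pos.1 (by
          have := Finset.pred_card_le_card_erase (s := T₁) (a := v)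
          omega)
        exact ⟨x, Finset.mem_of_mem_erase hx, Finset.ne_of_mem_erase hx⟩
      have hxA : x ∈ A := Finset.mem_of_mem_insert_of_ne (hT₁ hxT) hxv
      have hAx : (A.erase x).card + 1 = A.card := Finset.card_erase_add_one hxA
      have hAxA : A.erase x ⊆ A := Finset.erase_subset _ _
      by_cases hRx : Rainbow lab (insert v (A.erase x))
      · have hlx : (low lab (A.erase x)).card ≤ c := Finset.card_le_card (low_mono hAxA)
        obtain ⟨S₁, hS₁A, hS₁c, hS₁⟩ := exists_low_eq (hlx.trans hlow)
        obtain ⟨S, h0, hS, hSc⟩ := Finset.exists_subsuperset_card_eq hS₁A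
          (show S₁.card ≤ k by omega) (show k ≤ (A.erase x).card by omega)
        have hlS := low_eq_of_subset hS₁ h0 hS
        by_cases hlx' : (low lab (A.erase x)).card = c
        · have hvS : v ∉ S := fun h => hv (hAxA (hS h))
          refine ⟨_, hF (insert v S), Or.inr (Or.inl ?_)⟩
          rw [(hRx.mono (Finset.insert_subset_insert v hS)).card_col, low_insert,
            Finset.card_insert_of_notMem (fun h => hmem (low_mono (hS.trans hAxA) h)), hlS, hlx',
            Finset.card_insert_of_notMem hvS, hSc]
          omega
        · refine ⟨_, hF S, Or.inr (Or.inr ?_)⟩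
          have := one_le_card_low (lab := lab) (A.erase x)
          rw [(hR.mono (hS.trans hAxA)).card_col, hlS, hSc]
          omega
      · obtain ⟨T₂, hT₂, hc₂, U₂, hU₂, hd₂, he₂, hne₂⟩ := exists_of_not_rainbow hRx
        have hx : ∀ {T : Finset V}, T ⊆ insert v (A.erase x) → T ≠ T₁ := by
          rintro T hT rfl
          have := hT hxT
          simp [hxv] at this
        have hins : insert v (A.erase x) ⊆ insert v A := Finset.insert_subset_insert _ hAxA
        refine hfin ((T₁ ∪ U₁ ∪ (T₂ ∪ U₂)).erase v) ?_ ?_ fun S hWS h0 hSA => ?_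
        · rw [← Finset.subset_insert_iff]
          exact Finset.union_subset (Finset.union_subset hT₁ hU₁)
            (Finset.union_subset (hT₂.trans hins) (hU₂.trans hins))
        · have h3 := Finset.card_union_le (T₁ ∪ U₁) (T₂ ∪ U₂)
          have h4 := Finset.card_union_le T₁ U₁
          have h5 := Finset.card_union_le T₂ U₂
          have h6 := Finset.card_le_card (Finset.erase_subset v (T₁ ∪ U₁ ∪ (T₂ ∪ U₂)))
          omega
        · have hvS : v ∉ S := fun h => hv (hSA h)
          simp only [← Finset.subset_insert_iff, Finset.union_subset_iff] at hWS
          have h3 := card_col_add_two_le hWS.1.1 hc₁ hWS.2.1 hc₂ hWS.1.2 hd₁ hWS.2.2 hd₂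
            (hx hT₂).symm he₁ he₂ hne₁.symm (hx hU₂) hne₂.symm
          rw [Finset.card_insert_of_notMem hvS] at h3
          have h4 := hlowv v S hSA
          omega
    · -- all edges from `v` to `A` repeat colours of `A`, hence two of them already do so over a
      -- bounded set
      have hrep : ∀ v ∉ A, ∃ W ⊆ A, W.card ≤ 6 ∧ ∀ S, W ⊆ S → S ⊆ A →
          (col lab (insert v S)).card < (S.card + 1).choose 2 + c := by
        intro v hv
        obtain ⟨x₁, hx₁, x₂, hx₂, hxx⟩ := Finset.one_lt_card.1 (show 1 < A.card by omega)
        have hex : ∀ x ∈ A, ∃ U ⊆ A, U.card ≤ 2 ∧ lab U = lab {v, x} := by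
          intro x hx
          refine mem_col.1 ?_
          rw [← hins v]
          exact lab_mem_col (Finset.insert_subset (Finset.mem_insert_self _ _)
            (Finset.singleton_subset_iff.2 (Finset.mem_insert_of_mem hx))) (card_pair_le _ _)
        obtain ⟨U₁, hU₁, hd₁, he₁⟩ := hex x₁ hx₁
        obtain ⟨U₂, hU₂, hd₂, he₂⟩ := hex x₂ hx₂
        have hvx : ∀ x ∈ A, v ≠ x := fun x hx h => hv (h ▸ hx)
        have hUne : ∀ U ⊆ A, ∀ x, U ≠ {v, x} := by
          rintro U hU x rfl
          exact hv (hU (Finset.mem_insert_self _ _))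
        refine ⟨{x₁, x₂} ∪ (U₁ ∪ U₂), ?_, ?_, fun S hWS hSA => ?_⟩
        · exact Finset.union_subset (Finset.insert_subset hx₁ (Finset.singleton_subset_iff.2 hx₂))
            (Finset.union_subset hU₁ hU₂)
        · have h3 := Finset.card_union_le {x₁, x₂} (U₁ ∪ U₂)
          have h4 := Finset.card_union_le U₁ U₂
          have h5 := card_pair_le x₁ x₂
          omega
        · simp only [Finset.union_subset_iff, Finset.insert_subset_iff,
            Finset.singleton_subset_iff] at hWS
          have hsub : ∀ x ∈ S, ({v, x} : Finset V) ⊆ insert v S := fun x hx =>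
            Finset.insert_subset_insert _ (Finset.singleton_subset_iff.2 hx)
          have hSv := Finset.subset_insert v S
          have h3 := card_col_add_two_le (hsub x₁ hWS.1.1) (Finset.card_pair (hvx x₁ hx₁))
            (hsub x₂ hWS.1.2) (Finset.card_pair (hvx x₂ hx₂)) (hWS.2.1.trans hSv) hd₁
            (hWS.2.2.trans hSv) hd₂ (fun h => ?_) he₁.symm he₂.symm (hUne _ hU₁ _)
            (hUne _ hU₂ _) (hUne _ hU₂ _)
          · rw [Finset.card_insert_of_notMem fun h => hv (hSA h)] at h3
            have h4 := hlowv v S hSA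
            omega
          · have : x₁ ∈ ({v, x₂} : Finset V) := h ▸ by simp
            simp only [Finset.mem_insert, Finset.mem_singleton] at this
            exact this.elim (hvx x₁ hx₁).symm hxx
      obtain ⟨W, hWA, hWc, hW⟩ := hrep v hv
      obtain ⟨W', hWA', hWc', hW'⟩ := hrep w hw
      obtain ⟨S, hWS, hSA, hSc⟩ := Finset.exists_subsuperset_card_eq
        (s := S₀ ∪ (W ∪ W')) (t := A) (n := k)
        (Finset.union_subset hS₀A (Finset.union_subset hWA hWA'))
        (by
          have := Finset.card_union_le S₀ (W ∪ W')
          have := Finset.card_union_le W W'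
          omega) hka.le
      simp only [Finset.union_subset_iff] at hWS
      have := exists_between_of_pair hF hSA hvw (hW S hWS.2.1 hSA) (hW' S hWS.2.2 hSA) (by
        rw [hN S hWS.1 hSA, choose_two_succ S.card]; omega)
      rw [hN S hWS.1 hSA, hSc] at this
      obtain ⟨y, hy, h⟩ := this
      exact ⟨y, hy, Or.inl h⟩

end Labelling

/-! ### Gaps between consecutive values -/

/-- `F` is the set of values of an `m`-colouring, seen through labellings: every value is that of a
finite set under some labelling with colours in `Fin m` that uses all colours on a finite set and
has all its values in `F`. -/
def IsModelled (m : ℕ) (F : Finset ℕ) : Prop :=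
  ∀ f ∈ F, ∃ lab : Finset ℕ → Fin m, (∀ S, (col lab S).card ∈ F) ∧
    (∃ A, (col lab A).card = f) ∧ ∃ A, col lab A = Finset.univ

theorem one_le_card_col {V C : Type*} [DecidableEq V] [DecidableEq C] {lab : Finset V → C}
    (S : Finset V) : 1 ≤ (col lab S).card :=
  (one_le_card_low S).trans (Finset.card_le_card (low_subset_col S))

theorem card_col_empty {V C : Type*} [DecidableEq V] [DecidableEq C] (lab : Finset V → C) :
    (col lab ∅).card = 1 := by
  simp [col_eq, low]

namespace IsModelled

variable {m : ℕ} {F : Finset ℕ}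

theorem bounds (H : IsModelled m F) {f : ℕ} (hf : f ∈ F) : 1 ≤ f ∧ f ≤ m := by
  obtain ⟨lab, -, ⟨A, rfl⟩, -⟩ := H f hf
  exact ⟨one_le_card_col A, (Finset.card_le_univ _).trans (by simp)⟩

theorem one_mem (H : IsModelled m F) (hne : F.Nonempty) : 1 ∈ F := by
  obtain ⟨f, hf⟩ := hne
  obtain ⟨lab, hF, -⟩ := H f hf
  exact card_col_empty lab ▸ hF ∅

theorem max_mem (H : IsModelled m F) (hne : F.Nonempty) : m ∈ F := by
  obtain ⟨f, hf⟩ := hne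
  obtain ⟨lab, hF, -, A, hA⟩ := H f hf
  have := hF A
  rwa [hA, Finset.card_univ, Fintype.card_fin] at this

/-- In a critical set for the value `f`, every deletion leads to a value at most `p`, the predecessor
of `f`. -/
theorem exists_priv (H : IsModelled m F) {p f : ℕ} (hp : p ∈ F) (hf : f ∈ F) (hpf : p < f)
    (hcons : ∀ x ∈ F, x < f → x ≤ p) :
    ∃ lab : Finset ℕ → Fin m, (∀ S, (col lab S).card ∈ F) ∧ (∃ B, col lab B = Finset.univ) ∧
      ∃ A, (col lab A).card = f ∧ (∀ v ∈ A, f - p ≤ (priv lab A v).card) ∧ f - p ≤ A.card := by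
  obtain ⟨lab, hF, ⟨A', rfl⟩, hB⟩ := H f hf
  obtain ⟨A, hA, hcrit⟩ := exists_critical (lab := lab) A'
  have hpriv : ∀ v ∈ A, (col lab A').card - p ≤ (priv lab A v).card := by
    intro v hv
    have h1 := hcons _ (hF _) ((hcrit v hv).trans_eq hA)
    have h2 := card_priv (lab := lab) (S := A) v
    omega
  refine ⟨lab, hF, hB, A, hA, hpriv, ?_⟩
  rcases A.eq_empty_or_nonempty with rfl | ⟨v, hv⟩
  · rw [card_col_empty] at hA
    have := (H.bounds hp).1
    omega
  · exact (hpriv v hv).trans (card_priv_le v)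

/-- Consecutive values differ by at most the number of values below the larger. -/
theorem gap_le (H : IsModelled m F) {p f : ℕ} (hp : p ∈ F) (hf : f ∈ F) (hpf : p < f)
    (hcons : ∀ x ∈ F, x < f → x ≤ p) : f ≤ p + below F f := by
  obtain ⟨lab, hF, -, A, hA, hpriv, hcard⟩ := H.exists_priv hp hf hpf hcons
  have := le_below_of_priv hF hpriv hcard A subset_rfl
  rw [hA] at this
  omega

/-- Summing the gaps: if each gap at one of the last `q` values falls short of its bound by at least
`q`, the maximum `m` falls short of `F.card.choose 2 + 1` by `q * q`. -/
theorem add_mul_le (H : IsModelled m F) {q : ℕ} (hq : q < F.card)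
    (hgap : ∀ p ∈ F, ∀ f ∈ F, p < f → (∀ x ∈ F, x < f → x ≤ p) → F.card ≤ below F f + q →
      f + q ≤ p + below F f) :
    m + q * q ≤ F.card.choose 2 + 1 := by
  have hne : F.Nonempty := Finset.card_pos.1 (by omega)
  have key : ∀ i, ∀ f ∈ F, below F f = i → f + q * (i + 1 + q - F.card) ≤ (i + 1).choose 2 + 1 := by
    intro i
    induction i with
    | zero =>
      intro f hf hb
      have h1 : f ≤ 1 := by
        by_contra hcon
        have := below_add_one_le (H.one_mem hne) (not_le.1 hcon)
        omega
      rw [show 0 + 1 + q - F.card = 0 by omega]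
      simpa using h1
    | succ i ih =>
      intro f hf hb
      have hfne : (F.filter (· < f)).Nonempty := Finset.card_pos.1 (by
        change 0 < below F f
        omega)
      set p := (F.filter (· < f)).max' hfne with hpdef
      have hpmem := (F.filter (· < f)).max'_mem hfne
      rw [← hpdef, Finset.mem_filter] at hpmem
      have hcons : ∀ x ∈ F, x < f → x ≤ p := fun x hx hxf =>
        Finset.le_max' _ _ (Finset.mem_filter.2 ⟨hx, hxf⟩)
      have hbp : below F p + 1 = below F f := by
        have hn : p ∉ F.filter (· < p) := by simp
        rw [below, ← Finset.card_insert_of_notMem hn, below]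
        congr 1
        ext x
        simp only [Finset.mem_insert, Finset.mem_filter]
        constructor
        · rintro (rfl | h)
          · exact hpmem
          · exact ⟨h.1, h.2.trans hpmem.2⟩
        · rintro ⟨h1, h2⟩
          rcases (hcons x h1 h2).eq_or_lt with h | h
          · exact Or.inl h
          · exact Or.inr ⟨h1, h⟩
      have h1 := ih p hpmem.1 (by omega)
      have h2 := H.gap_le hpmem.1 hf hpmem.2 hcons
      have h3 := choose_two_succ (i + 1)
      by_cases hlarge : F.card ≤ i + 1 + q
      · have h4 := hgap p hpmem.1 f hf hpmem.2 hcons (by omega)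
        rw [show i + 1 + 1 + q - F.card = (i + 1 + q - F.card) + 1 by omega, mul_add, mul_one]
        omega
      · rw [show i + 1 + 1 + q - F.card = 0 by omega]
        rw [show i + 1 + q - F.card = 0 by omega] at h1
        omega
  have hmF := H.max_mem hne
  have hbm : below F m = F.card - 1 := by
    rw [← Finset.card_erase_of_mem hmF, below]
    congr 1
    ext x
    simp only [Finset.mem_filter, Finset.mem_erase]
    constructor
    · exact fun h => ⟨h.2.ne, h.1⟩
    · exact fun h => ⟨h.2, lt_of_le_of_ne (H.bounds h.2).2 h.1⟩
  have := key _ m hmF hbm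
  rwa [show F.card - 1 + 1 + q - F.card = q by omega,
    show F.card - 1 + 1 = F.card by omega] at this

theorem le_choose (H : IsModelled m F) (hne : F.Nonempty) : m ≤ F.card.choose 2 + 1 := by
  have := H.add_mul_le (q := 0) (Finset.card_pos.2 hne)
    (fun p hp f hf hpf hc _ => by simpa using H.gap_le hp hf hpf hc)
  simpa using this

theorem le_choose_two_add_one (n : ℕ) : n ≤ n.choose 2 + 1 := by
  induction n with
  | zero => simp
  | succ n ih =>
    rw [choose_two_succ]
    rcases Nat.eq_zero_or_pos n with rfl | h
    · simp
    · omega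

/-- A structured set of largest size does not carry all `m` colours, as its number of colours is of
one of the excluded forms. -/
theorem four_mul_le_of_structured {lab : Finset ℕ → Fin m} (hF : ∀ S, (col lab S).card ∈ F)
    (hfull : ∃ B, col lab B = Finset.univ)
    (hm : ∀ n : ℕ, 2 ≤ n → m ≠ n.choose 2 + 1 ∧ m ≠ n.choose 2 + 2)
    {S : Finset ℕ} (hS : Structured lab S) {n : ℕ} (hn : 3 * n + 12 ≤ S.card) :
    4 * n ≤ F.card := by
  have hbdd : ∀ S, Structured lab S → S.card ≤ m := by
    intro S hS
    obtain ⟨k, hk, hN⟩ := hS.card_col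
    have h1 : (col lab S).card ≤ m := (Finset.card_le_univ _).trans (by simp)
    have h2 := le_choose_two_add_one k
    omega
  have hmem : sSup {k | ∃ S, Structured lab S ∧ S.card = k} ∈
      {k | ∃ S, Structured lab S ∧ S.card = k} :=
    Nat.sSup_mem ⟨_, S, hS, rfl⟩ ⟨m, by rintro k ⟨S, hS, rfl⟩; exact hbdd S hS⟩
  obtain ⟨A, hA, hAk⟩ := hmem
  have hmaxA : ∀ S, Structured lab S → S.card ≤ A.card := by
    intro S hS
    rw [hAk]
    exact le_csSup ⟨m, by rintro k ⟨S, hS, rfl⟩; exact hbdd S hS⟩ ⟨S, hS, rfl⟩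
  have hSA := hmaxA S hS
  have hmax : ∀ v ∉ A, ¬ Structured lab (insert v A) := by
    intro v hv hcon
    have := hmaxA _ hcon
    rw [Finset.card_insert_of_notMem hv] at this
    omega
  have hnew : ∃ T : Finset ℕ, T.card ≤ 2 ∧ lab T ∉ col lab A := by
    obtain ⟨B, hB⟩ := hfull
    by_contra hcon
    push Not at hcon
    have hcol : col lab A = Finset.univ := by
      rw [← Finset.univ_subset_iff, ← hB]
      intro c hc
      obtain ⟨T, -, h2, rfl⟩ := mem_col.1 hc
      exact hcon T h2
    obtain ⟨k, hk, hN⟩ := hA.card_col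
    rw [hcol, Finset.card_univ, Fintype.card_fin] at hN
    have := hm k (by omega)
    tauto
  rcases hA.2 with h | h
  · exact four_mul_le_card_of_card_low_le hF hA.1 h hmax hnew (hn.trans hSA)
  · exact four_mul_le_card_of_injective hF hA.1 h hmax hnew (hn.trans hSA)

/-- A gap among the last values that is nearly as large as possible would produce a large structured
set, hence more values than `F` has. -/
theorem gap_add_le (H : IsModelled m F)
    (hm : ∀ n : ℕ, 2 ≤ n → m ≠ n.choose 2 + 1 ∧ m ≠ n.choose 2 + 2)
    {q : ℕ} (hq : 100 * q ≤ F.card) (hF : 1000 ≤ F.card)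
    {p f : ℕ} (hp : p ∈ F) (hf : f ∈ F) (hpf : p < f)
    (hcons : ∀ x ∈ F, x < f → x ≤ p) (hb : F.card ≤ below F f + q) :
    f + q ≤ p + below F f := by
  by_contra! hcon
  obtain ⟨lab, hFlab, hfull, A, hA, hpriv, hcard⟩ := H.exists_priv hp hf hpf hcons
  have hbF := below_add_one_le_card hf
  set s := F.card with hs
  set d := f - p with hd
  have hAd : A.card * d ≤ s * s := by
    have h1 : A.card * d ≤ ∑ v ∈ A, (priv lab A v).card := by
      rw [← smul_eq_mul]; exact Finset.card_nsmul_le_sum _ _ _ hpriv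
    have h2 := sum_card_priv_le (lab := lab) A
    rw [hA] at h2
    have h3 := (H.bounds hf).2
    have h4 := H.le_choose ⟨f, hf⟩
    rw [← hs, Nat.choose_two_right] at h4
    have h5 := Nat.div_mul_le_self (s * (s - 1)) 2
    have h6 : s * (s - 1) + s = s * s := by
      rw [← Nat.mul_succ, Nat.succ_eq_add_one, Nat.sub_add_cancel (by omega)]
    omega
  have hd98 : 98 * s ≤ 100 * d := by omega
  have hA98 : 98 * A.card ≤ 100 * s := by
    refine Nat.le_of_mul_le_mul_right ?_ (show 0 < s by omega)
    calc 98 * A.card * s = A.card * (98 * s) := by ring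
      _ ≤ A.card * (100 * d) := Nat.mul_le_mul_left _ hd98
      _ = 100 * (A.card * d) := by ring
      _ ≤ 100 * (s * s) := Nat.mul_le_mul_left _ hAd
      _ = 100 * s * s := by ring
  obtain ⟨S, hS, hSc⟩ := exists_structured hFlab hpriv hcard (by rw [hA]; omega)
    (by rw [hA]; omega) (by rw [hA]; omega)
  rw [hA] at hSc
  have := four_mul_le_of_structured hFlab hfull hm hS (n := (S.card - 12) / 3) (by omega)
  omega

theorem add_sq_le (H : IsModelled m F)
    (hm : ∀ n : ℕ, 2 ≤ n → m ≠ n.choose 2 + 1 ∧ m ≠ n.choose 2 + 2) (hF : 1000 ≤ F.card) :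
    m + (F.card / 100) * (F.card / 100) ≤ F.card.choose 2 + 1 :=
  H.add_mul_le (by omega) fun _ hp _ hf hpf hc hb =>
    H.gap_add_le hm (by omega) hF hp hf hpf hc hb

end IsModelled

/-! ### Labellings from an ultrafilter -/

section Model

open Filter

theorem mem_coloursOn {C : Type*} {Δ : SimpleGraph.TopEdgeLabeling ℕ C} {X : Set ℕ} {c : C} :
    c ∈ coloursOn Δ X ↔ ∃ x ∈ X, ∃ y ∈ X, ∃ h : x ≠ y,
      Δ ⟨s(x, y), by simpa using h⟩ = c := by
  constructor
  · rintro ⟨⟨e, he⟩, hX, rfl⟩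
    induction e using Sym2.ind with
    | _ x y =>
      exact ⟨x, hX x (by simp), y, hX y (by simp), by simpa using he, rfl⟩
  · rintro ⟨x, hx, y, hy, h, rfl⟩
    refine ⟨_, ?_, rfl⟩
    intro v hv
    rcases Sym2.mem_iff.1 hv with rfl | rfl
    · exact hx
    · exact hy

/-- Labels of pairs are read off a function on `Sym2 ℕ`, so that the two orderings agree. -/
theorem exists_lab {C : Type*} (c₀ : C) (κ : ℕ → C) (χ : Sym2 ℕ → C) :
    ∃ lab : Finset ℕ → C, lab ∅ = c₀ ∧ (∀ x, lab {x} = κ x) ∧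
      ∀ x y, x ≠ y → lab {x, y} = χ s(x, y) := by
  classical
  refine ⟨fun T => if T = ∅ then c₀ else if h : ∃ x, T = {x} then κ h.choose else
    if h : ∃ x y, T = {x, y} then χ s(h.choose, h.choose_spec.choose) else c₀, ?_, ?_, ?_⟩
  · simp
  · intro x
    simp
  · intro x y hxy
    have h1 : ¬ ∃ z, ({x, y} : Finset ℕ) = {z} := by
      rintro ⟨z, hz⟩
      have := congrArg Finset.card hz
      rw [Finset.card_pair hxy, Finset.card_singleton] at this
      omega
    have h : ∃ z w, ({x, y} : Finset ℕ) = {z, w} := ⟨x, y, rfl⟩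
    have h2 := h.choose_spec.choose_spec
    simp only [Finset.insert_ne_empty, if_false, dif_neg h1, dif_pos h]
    congr 1
    generalize h.choose_spec.choose = w at h2
    generalize h.choose = z at h2
    rw [Sym2.eq_iff]
    have hz : z = x ∨ z = y := by
      have : z ∈ ({x, y} : Finset ℕ) := h2 ▸ by simp
      simpa using this
    have hw : w = x ∨ w = y := by
      have : w ∈ ({x, y} : Finset ℕ) := h2 ▸ by simp
      simpa using this
    have hx : x = z ∨ x = w := by
      have : x ∈ ({z, w} : Finset ℕ) := h2 ▸ by simp
      simpa using this
    have hy : y = z ∨ y = w := by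
      have : y ∈ ({z, w} : Finset ℕ) := h2 ▸ by simp
      simpa using this
    rcases hz with rfl | rfl <;> rcases hw with rfl | rfl <;> simp_all

/-- The labels are limits along an ultrafilter `U` of infinite subsets of `X`: `lab {x}` is the colour
of `xy` for `U`-most `y`, and `lab ∅` is `lab {x}` for `U`-most `x`. An infinite set `B` with these
colours exactly is chosen vertex by vertex. -/
theorem exists_model {m : ℕ} {Δ : SimpleGraph.TopEdgeLabeling ℕ (Fin m)}
    (hΔ : IsExactColouring Δ) {X : Set ℕ} (hX : X.Infinite) :
    ∃ lab : Finset ℕ → Fin m, (∀ S, (col lab S).card ∈ spannedCounts Δ) ∧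
      (∃ A, (col lab A).card = numColours Δ X) ∧ ∃ A, col lab A = Finset.univ := by
  classical
  have : Nonempty (Fin m) := ⟨Δ ⟨s(0, 1), by simp⟩⟩
  set χ : Sym2 ℕ → Fin m := fun e =>
    if h : e ∈ (⊤ : SimpleGraph ℕ).edgeSet then Δ ⟨e, h⟩ else Classical.arbitrary _ with hχ
  have hχΔ : ∀ x y (h : x ≠ y), Δ ⟨s(x, y), by simpa using h⟩ = χ s(x, y) := by
    intro x y h
    simp [hχ, h]
  have hne : (cofinite ⊓ 𝓟 X).NeBot := hX.cofinite_inf_principal_neBot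
  set U := Ultrafilter.of (cofinite ⊓ 𝓟 X) with hU
  have hUle : (U : Filter ℕ) ≤ cofinite ⊓ 𝓟 X := Ultrafilter.of_le _
  have hlim : ∀ g : ℕ → Fin m, ∃ c, ∀ᶠ y in (U : Filter ℕ), g y = c := by
    intro g
    obtain ⟨c, hc⟩ := Ultrafilter.eq_pure_of_finite (U.map g)
    refine ⟨c, ?_⟩
    have : ({c} : Set (Fin m)) ∈ U.map g := hc ▸ (Set.mem_singleton c)
    exact this
  choose κ hκ using fun x => hlim fun y => χ s(x, y)
  obtain ⟨c₀, hc₀⟩ := hlim κ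
  have hUX : ∀ᶠ y in (U : Filter ℕ), y ∈ X :=
    hUle (mem_inf_of_right (mem_principal_self X))
  have hUne : ∀ x, ∀ᶠ y in (U : Filter ℕ), y ≠ x := fun x =>
    hUle (mem_inf_of_left (by simp [mem_cofinite]))
  obtain ⟨lab, h0, h1, h2⟩ := exists_lab c₀ κ χ
  -- realise `col lab S` by an infinite set
  have hreal : ∀ S : Finset ℕ, ∃ B ⊆ X, B.Infinite ∧
      coloursOn Δ (S ∪ B) = (col lab S : Set (Fin m)) := by
    intro S
    obtain ⟨g, hg1, hg2⟩ := exists_seq_of_forall_finset_exists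
      (fun y => y ∈ X ∧ κ y = c₀ ∧ ∀ a ∈ S, y ≠ a ∧ χ s(a, y) = κ a)
      (fun x y => y ≠ x ∧ χ s(x, y) = c₀) (by
        intro s hs
        have hev : ∀ᶠ y in (U : Filter ℕ), (y ∈ X ∧ κ y = c₀ ∧ ∀ a ∈ S, y ≠ a ∧
            χ s(a, y) = κ a) ∧ ∀ x ∈ s, y ≠ x ∧ χ s(x, y) = c₀ := by
          refine (hUX.and (hc₀.and ?_)).and ?_
          · exact (Finset.eventually_all S).2 fun a _ => (hUne a).and (hκ a)
          · refine (Finset.eventually_all s).2 fun x hx => (hUne x).and ?_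
            filter_upwards [hκ x] with y hy
            rw [hy, (hs x hx).2.1]
        exact hev.exists)
    have hginj : Function.Injective g := by
      intro a b hab
      rcases lt_trichotomy a b with h | h | h
      · exact absurd hab.symm (hg2 a b h).1
      · exact h
      · exact absurd hab (hg2 b a h).1
    have hgg : ∀ a b, g a ≠ g b → χ s(g a, g b) = c₀ := by
      intro a b hab
      rcases lt_trichotomy a b with h | h | h
      · exact (hg2 a b h).2
      · exact absurd (h ▸ rfl) hab
      · rw [Sym2.eq_swap]; exact (hg2 b a h).2
    refine ⟨Set.range g, by rintro _ ⟨n, rfl⟩; exact (hg1 n).1,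
      Set.infinite_range_of_injective hginj, ?_⟩
    ext c
    rw [mem_coloursOn, Finset.mem_coe]
    constructor
    · rintro ⟨x, hx, y, hy, hxy, rfl⟩
      rw [hχΔ x y hxy]
      rcases hx with hx | ⟨a, rfl⟩ <;> rcases hy with hy | ⟨b, rfl⟩
      · rw [← h2 x y hxy]
        exact lab_mem_col (Finset.insert_subset hx (Finset.singleton_subset_iff.2 hy))
          (card_pair_le _ _)
      · rw [((hg1 b).2.2 x hx).2, ← h1]
        exact lab_mem_col (Finset.singleton_subset_iff.2 hx) (by simp)
      · rw [Sym2.eq_swap, ((hg1 a).2.2 y hy).2, ← h1]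
        exact lab_mem_col (Finset.singleton_subset_iff.2 hy) (by simp)
      · rw [hgg a b hxy, ← h0]
        exact lab_mem_col (by simp) (by simp)
    · intro hc
      obtain ⟨T, hT, hT2, rfl⟩ := mem_col.1 hc
      rcases T.eq_empty_or_nonempty with rfl | ⟨x, hx⟩
      · have hne : g 0 ≠ g 1 := fun h => absurd (hginj h) (by simp)
        exact ⟨g 0, Or.inr ⟨0, rfl⟩, g 1, Or.inr ⟨1, rfl⟩, hne,
          by rw [hχΔ _ _ hne, hgg _ _ hne, h0]⟩
      · obtain ⟨y, hy, rfl⟩ := exists_eq_pair hx hT2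
        by_cases hxy : x = y
        · subst hxy
          have hxS : x ∈ S := hT hx
          have hne := ((hg1 0).2.2 x hxS).1.symm
          refine ⟨x, Or.inl hxS, g 0, Or.inr ⟨0, rfl⟩, hne, ?_⟩
          rw [hχΔ _ _ hne, ((hg1 0).2.2 x hxS).2, Finset.pair_eq_singleton, h1]
        · exact ⟨x, Or.inl (hT hx), y, Or.inl (hT hy), hxy, by rw [hχΔ _ _ hxy, h2 _ _ hxy]⟩
  -- finitely many edges carry all colours of a given set
  have hcover : ∀ Y : Set ℕ, ∃ A : Finset ℕ, (A : Set ℕ) ⊆ Y ∧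
      coloursOn Δ Y ⊆ (col lab A : Set (Fin m)) := by
    intro Y
    have hch : ∀ c : Fin m, ∃ A : Finset ℕ, (A : Set ℕ) ⊆ Y ∧
        (c ∈ coloursOn Δ Y → c ∈ col lab A) := by
      intro c
      by_cases hc : c ∈ coloursOn Δ Y
      · obtain ⟨x, hx, y, hy, hxy, rfl⟩ := mem_coloursOn.1 hc
        refine ⟨{x, y}, by simp [Set.insert_subset_iff, hx, hy], fun _ => ?_⟩
        rw [hχΔ x y hxy, ← h2 x y hxy]
        exact lab_mem_col subset_rfl (card_pair_le _ _)
      · exact ⟨∅, by simp, fun h => absurd h hc⟩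
    choose t ht1 ht2 using hch
    refine ⟨Finset.univ.biUnion t, ?_, fun c hc => ?_⟩
    · simpa using ht1
    · exact col_mono (Finset.subset_biUnion_of_mem t (Finset.mem_univ c)) (ht2 c hc)
  refine ⟨lab, fun S => ?_, ?_, ?_⟩
  · obtain ⟨B, -, hB, hcol⟩ := hreal S
    refine ⟨S ∪ B, hB.mono Set.subset_union_right, ?_⟩
    rw [numColours, hcol, Set.ncard_coe_finset]
  · obtain ⟨A, hAX, hA⟩ := hcover X
    refine ⟨A, ?_⟩
    have : coloursOn Δ X = (col lab A : Set (Fin m)) := by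
      refine Set.Subset.antisymm hA ?_
      obtain ⟨B, hBX, -, hcol⟩ := hreal A
      rw [← hcol]
      refine Set.image_mono fun e he v hv => ?_
      exact Set.union_subset hAX hBX (he v hv)
    rw [numColours, this, Set.ncard_coe_finset]
  · obtain ⟨A, -, hA⟩ := hcover Set.univ
    refine ⟨A, Finset.eq_univ_iff_forall.2 fun c => hA ?_⟩
    obtain ⟨e, rfl⟩ := hΔ c
    exact ⟨e, fun v _ => Set.mem_univ v, rfl⟩

theorem isModelled {m : ℕ} {Δ : SimpleGraph.TopEdgeLabeling ℕ (Fin m)}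
    (hΔ : IsExactColouring Δ) : IsModelled m (spannedCounts_finite Δ).toFinset := by
  intro f hf
  rw [Set.Finite.mem_toFinset] at hf
  obtain ⟨X, hX, rfl⟩ := hf
  simpa using exists_model hΔ hX

end Model

/-! ### The bounds for colourings of `ℕ` -/

section Final

variable {m : ℕ} {Δ : SimpleGraph.TopEdgeLabeling ℕ (Fin m)}

theorem toFinset_nonempty (Δ : SimpleGraph.TopEdgeLabeling ℕ (Fin m)) :
    (spannedCounts_finite Δ).toFinset.Nonempty :=
  ⟨numColours Δ Set.univ, by simpa using ⟨Set.univ, Set.infinite_univ, rfl⟩⟩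

theorem two_mul_choose_two (n : ℕ) : 2 * (n.choose 2 : ℝ) = (n : ℝ) ^ 2 - n := by
  rw [Nat.cast_choose_two]
  ring

theorem le_choose_ncard (hΔ : IsExactColouring Δ) :
    m ≤ (spannedCounts Δ).ncard.choose 2 + 1 := by
  rw [Set.ncard_eq_toFinset_card _ (spannedCounts_finite Δ)]
  exact (isModelled hΔ).le_choose (toFinset_nonempty Δ)

theorem two_mul_le_sq (hΔ : IsExactColouring Δ)
    (hm : ∀ n : ℕ, 2 ≤ n → m ≠ n.choose 2 + 1 ∧ m ≠ n.choose 2 + 2)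
    (hs : 1000 ≤ (spannedCounts Δ).ncard) :
    2 * (m : ℝ) + (spannedCounts Δ).ncard ≤ (1 - 1 / 20000) * (spannedCounts Δ).ncard ^ 2 + 2 := by
  have h := (isModelled hΔ).add_sq_le hm
    (by rwa [← Set.ncard_eq_toFinset_card _ (spannedCounts_finite Δ)])
  rw [← Set.ncard_eq_toFinset_card _ (spannedCounts_finite Δ)] at h
  set s := (spannedCounts Δ).ncard
  set q := s / 100 with hq
  have hqs : s ≤ 200 * q := by omega
  have hqs' : (s : ℝ) ≤ 200 * q := by exact_mod_cast hqs
  have h' : (m : ℝ) + q * q ≤ s.choose 2 + 1 := by exact_mod_cast h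
  have h2 := two_mul_choose_two s
  have h3 : (s : ℝ) * s ≤ (200 * q) * (200 * q) := mul_self_le_mul_self (by positivity) hqs'
  linarith

theorem mul_sqrt_le_ncard (hm2 : 2 ≤ m) (hΔ : IsExactColouring Δ)
    (hm : ∀ n : ℕ, 2 ≤ n → m ≠ n.choose 2 + 1 ∧ m ≠ n.choose 2 + 2) :
    (1 + 1 / 10000000) * Real.sqrt (2 * (m : ℝ)) ≤ ((spannedCounts Δ).ncard : ℝ) := by
  have hm4 : 4 ≤ m := by
    have := hm 2 le_rfl
    rw [Nat.choose_self] at this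
    omega
  have hle := le_choose_ncard hΔ
  have hbig := two_mul_le_sq hΔ hm
  set s := (spannedCounts Δ).ncard
  have hs3 : 3 ≤ s := by
    by_contra hcon
    have := Nat.choose_le_choose 2 (show s ≤ 2 by omega)
    rw [Nat.choose_self] at this
    omega
  have hs3' : (3 : ℝ) ≤ s := by exact_mod_cast hs3
  have hle' : (m : ℝ) ≤ s.choose 2 + 1 := by exact_mod_cast hle
  have h2 := two_mul_choose_two s
  have hsq := Real.sq_sqrt (show (0 : ℝ) ≤ 2 * m by positivity)
  refine le_of_pow_le_pow_left₀ two_ne_zero (by positivity) ?_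
  rw [mul_pow, hsq]
  rcases lt_or_ge s 1000 with h | h
  · have h' : (s : ℝ) ≤ 1000 := by exact_mod_cast h.le
    nlinarith
  · have := hbig h
    nlinarith

theorem lt_ncard_of_choose_add_three {n : ℕ}
    {Δ : SimpleGraph.TopEdgeLabeling ℕ (Fin (n.choose 2 + 3))} (hΔ : IsExactColouring Δ) :
    (1 + 1 / 10000000) * (n : ℝ) < ((spannedCounts Δ).ncard : ℝ) := by
  have hle := le_choose_ncard hΔ
  have hbig := two_mul_le_sq hΔ
  set s := (spannedCounts Δ).ncard
  have hsn : n + 1 ≤ s := by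
    by_contra hcon
    have := Nat.choose_le_choose 2 (show s ≤ n by omega)
    omega
  have hsn' : (n : ℝ) + 1 ≤ s := by exact_mod_cast hsn
  rcases lt_or_ge n 1000000 with h | h
  · have h' : (n : ℝ) < 1000000 := by exact_mod_cast h
    linarith
  · have := hbig (fun k _ => by
      rcases le_or_gt k n with hk | hk
      · have := Nat.choose_le_choose 2 hk
        omega
      · have h1 := Nat.choose_le_choose 2 (show n + 1 ≤ k from hk)
        have h2 := choose_two_succ n
        omega) (by omega)
    have h2 := two_mul_choose_two n
    push_cast at this
    refine lt_of_pow_lt_pow_left₀ 2 (by positivity) ?_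
    nlinarith

end Final

end CanonicalColouring

theorem theorem2 :
    (∃ α : ℝ, 0 < α ∧ ∀ m : ℕ, 2 ≤ m →
      (∀ n : ℕ, 2 ≤ n → m ≠ n.choose 2 + 1 ∧ m ≠ n.choose 2 + 2) →
        (1 + α) * Real.sqrt (2 * (m : ℝ)) ≤ (psi m : ℝ) ∧
        ∀ Δ : SimpleGraph.TopEdgeLabeling ℕ (Fin m), IsExactColouring Δ →
          (1 + α) * Real.sqrt (2 * (m : ℝ)) ≤ ((spannedCounts Δ).ncard : ℝ)) ∧
    (∃ c : ℝ, 0 < c ∧ ∀ n : ℕ, 2 ≤ n →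
      (1 + c) * (n : ℝ) < (psi (n.choose 2 + 3) : ℝ)) := by
  refine ⟨⟨1 / 10000000, by norm_num, fun m hm2 hm => ⟨?_, fun Δ hΔ => ?_⟩⟩,
    1 / 10000000, by norm_num, fun n _ => ?_⟩
  · obtain ⟨Δ, hΔ, h⟩ := (psi_isLeast (show 1 ≤ m by omega)).1
    rw [← h]
    exact CanonicalColouring.mul_sqrt_le_ncard hm2 hΔ hm
  · exact CanonicalColouring.mul_sqrt_le_ncard hm2 hΔ hm
  · obtain ⟨Δ, hΔ, h⟩ := (psi_isLeast (show 1 ≤ n.choose 2 + 3 by omega)).1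
    rw [← h]
    exact CanonicalColouring.lt_ncard_of_choose_add_three hΔ
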